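/- Fix a base $b>1$ for all logarithms. For a real random variable $X$, let $H(X)=\sum_x \Pr\{X=x\}\log_b\frac{1}{\Pr\{X=x\}}$ if $X$ is discrete and $H(X)=\infty$ otherwise. For $\mathsf{snr}>0$ let $I(X,\mathsf{snr})=I(X;\sqrt{\mathsf{snr}}\,X+Z)$ be the mutual information between the input and the output of the Gaussian channel, where $Z\sim\mathcal N(0,1)$ is independent of $X$. For $h>0$ define the entropy-constrained capacity $$C_H(h,\mathsf{snr})=\sup_{\mathbb E[X^2]\le 1,\ H(X)\le h} I(X,\mathsf{snr}),$$ where the supremum is over all distributions of $X$ on $\mathbb R$ that satisfy the constraints. Then, for all $h,\mathsf{snr}>0$, the supremum is finite and is attained: $$C_H(h,\mathsf{snr})=\max_{\mathbb E[X^2]\le 1,\ H(X)\le h} I(X,\mathsf{snr}).$$ Moreover, every maximizing $X$ has zero mean, unit variance, and entropy exactly $h$. -/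

import Mathlib

open MeasureTheory ProbabilityTheory
open scoped ENNReal

noncomputable section

/-- The Shannon entropy, with logarithms to base `b`, of a distribution `μ` on `ℝ`:
`∑ₓ μ{x} log_b (1 / μ{x})` if `μ` is discrete (carried by a countable set), and `∞` otherwise. -/
def entropy (b : ℝ) (μ : Measure ℝ) : ℝ≥0∞ :=
  open Classical in
  if ∃ S : Set ℝ, S.Countable ∧ μ Sᶜ = 0 then
    ∑' x : ℝ, ENNReal.ofReal (μ.real {x} * Real.logb b (1 / μ.real {x}))
  else ⊤

/-- The mutual information `I(X; Y)`, with logarithms to base `b`: the Kullback-Leibler divergence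
of the joint law of `(X, Y)` from the product of its marginals. Mathlib's divergence uses the
natural logarithm, whence the division by `log b`. -/
def mutualInfo {Ω α β : Type*} [MeasurableSpace Ω] [MeasurableSpace α] [MeasurableSpace β]
    (b : ℝ) (X : Ω → α) (Y : Ω → β) (P : Measure Ω) : ℝ≥0∞ :=
  InformationTheory.klDiv (P.map (fun ω => (X ω, Y ω))) ((P.map X).prod (P.map Y)) /
    ENNReal.ofReal (Real.log b)

/-- `I(X, snr) = I(X; √snr X + Z)`, where `X` has law `μ` and `Z` is a standard Gaussian
independent of `X`; the pair `(X, Z)` is realized as the two coordinates on `ℝ × ℝ`. -/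
def gaussianChannelInfo (b : ℝ) (μ : Measure ℝ) (snr : ℝ) : ℝ≥0∞ :=
  mutualInfo b (fun p : ℝ × ℝ => p.1) (fun p : ℝ × ℝ => √snr * p.1 + p.2)
    (μ.prod (gaussianReal 0 1))

/-- The input distributions with `E[X²] ≤ 1` and `H(X) ≤ h`. -/
def feasibleInputs (b h : ℝ) : Set (ProbabilityMeasure ℝ) :=
  {μ | ∫⁻ x, ENNReal.ofReal (x ^ 2) ∂(μ : Measure ℝ) ≤ 1 ∧
    entropy b (μ : Measure ℝ) ≤ ENNReal.ofReal h}

/-- The entropy-constrained capacity `C_H(h, snr)` of the Gaussian channel. -/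
def entropyCapacity (b h snr : ℝ) : ℝ≥0∞ :=
  ⨆ μ ∈ feasibleInputs b h, gaussianChannelInfo b (μ : Measure ℝ) snr

end

open Filter Topology

/-! Write `s = √snr`. The output `s X + Z` has a density `p` bounded by the peak of the Gaussian
kernel, so `p log (peak / p)` is nonnegative. Its integral `outputEntropy` is differential entropy
up to a constant and equals the mutual information in nats plus `1/2` (`channelInfo_add_half`).
Maximizing information is therefore maximizing `outputEntropy`. The identity
`outputEntropy_add_outputDiv` says that this entropy plus the divergence of the output from `N(0,
v)` depends only on `v`, `s` and the second moment of the input. It gives finiteness, the Gaussian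
upper bound and, for large `v`, upper semicontinuity.

Existence is by compactness. Feasible inputs are discrete, and their atoms are indexed by `ℕ × ℕ`,
the first coordinate being the rounded-down reciprocal of the mass (`exists_indexed_atoms`). An
entropy bound makes the masses uniformly summable over these indices, so no mass is lost in a limit
(`tsum_limit_eq_one`). The second moment bound keeps the positions of atoms with nonvanishing
limiting mass from escaping to infinity (`exists_subseq_atoms`). Fatou keeps both constraints in the
limit, merging of atoms only lowers the entropy, and upper semicontinuity
(`outputEntropy_ge_of_tendsto`) makes the limit of a maximizing sequence optimal.

A maximizer uses all its entropy: a discrete input stays strictly below the Gaussian output entropy,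
so some finitely supported input does strictly better. Mixing in a little of it costs little entropy
and, by concavity, gains information (`exists_channelInfo_gt_of_entropy_lt`). A maximizer is also
standardized: otherwise it can be centered and scaled up without changing its entropy, and the
original channel is then a degraded version of the new one. Strict Jensen makes the gain strict as
soon as the information is nonzero (`channelInfo_degraded_lt`). -/

/-! ### The Gaussian kernel and the output density -/

/-- The maximum of the standard Gaussian density. -/
noncomputable def gaussianPeak : ℝ := (√(2 * Real.pi))⁻¹

lemma gaussianPeak_pos : 0 < gaussianPeak := by
  unfold gaussianPeak
  positivity

lemma gaussianPDFReal_one_eq (m y : ℝ) :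
    gaussianPDFReal m 1 y = gaussianPeak * Real.exp (-(y - m) ^ 2 / 2) := by
  simp [gaussianPDFReal, gaussianPeak]

lemma gaussianPDFReal_one_le (m y : ℝ) : gaussianPDFReal m 1 y ≤ gaussianPeak := by
  rw [gaussianPDFReal_one_eq]
  refine mul_le_of_le_one_right gaussianPeak_pos.le (Real.exp_le_one_iff.2 ?_)
  nlinarith [sq_nonneg (y - m)]

lemma measurable_gaussianPDF_uncurry (s : ℝ) (v : NNReal) :
    Measurable fun p : ℝ × ℝ => gaussianPDF (s * p.1) v p.2 := by
  unfold gaussianPDF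
  refine ENNReal.measurable_ofReal.comp ?_
  unfold gaussianPDFReal
  fun_prop

lemma measurable_gaussianPDF_left (s : ℝ) (v : NNReal) (y : ℝ) :
    Measurable fun x : ℝ => gaussianPDF (s * x) v y := by
  unfold gaussianPDF
  refine ENNReal.measurable_ofReal.comp ?_
  unfold gaussianPDFReal
  fun_prop

/-- The density of `s X + Z`, where `X` has law `μ` and `Z` is a standard Gaussian independent
of `X`. -/
noncomputable def outputDensity (μ : Measure ℝ) (s y : ℝ) : ℝ≥0∞ :=
  ∫⁻ x, gaussianPDF (s * x) 1 y ∂μ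

lemma measurable_outputDensity (μ : Measure ℝ) [SFinite μ] (s : ℝ) :
    Measurable (outputDensity μ s) :=
  (measurable_gaussianPDF_uncurry s 1).lintegral_prod_left'

lemma outputDensity_le (μ : Measure ℝ) [IsProbabilityMeasure μ] (s y : ℝ) :
    outputDensity μ s y ≤ ENNReal.ofReal gaussianPeak := by
  calc outputDensity μ s y ≤ ∫⁻ _, ENNReal.ofReal gaussianPeak ∂μ :=
        lintegral_mono fun x => ENNReal.ofReal_le_ofReal (gaussianPDFReal_one_le _ _)
    _ = _ := by simp

lemma outputDensity_ne_top (μ : Measure ℝ) [IsProbabilityMeasure μ] (s y : ℝ) :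
    outputDensity μ s y ≠ ⊤ :=
  ((outputDensity_le μ s y).trans_lt ENNReal.ofReal_lt_top).ne

lemma outputDensity_ne_zero (μ : Measure ℝ) [IsProbabilityMeasure μ] (s y : ℝ) :
    outputDensity μ s y ≠ 0 := by
  intro h
  have hm := measurable_gaussianPDF_left s 1 y
  have h0 := (lintegral_eq_zero_iff hm).1 h
  obtain ⟨x, hx⟩ := h0.exists
  exact (gaussianPDF_pos (s * x) (v := 1) one_ne_zero y).ne' hx

lemma outputDensity_toReal_pos (μ : Measure ℝ) [IsProbabilityMeasure μ] (s y : ℝ) :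
    0 < (outputDensity μ s y).toReal :=
  ENNReal.toReal_pos (outputDensity_ne_zero μ s y) (outputDensity_ne_top μ s y)

lemma outputDensity_toReal_le (μ : Measure ℝ) [IsProbabilityMeasure μ] (s y : ℝ) :
    (outputDensity μ s y).toReal ≤ gaussianPeak :=
  ENNReal.toReal_le_of_le_ofReal gaussianPeak_pos.le (outputDensity_le μ s y)

lemma ofReal_outputDensity_toReal (μ : Measure ℝ) [IsProbabilityMeasure μ] (s y : ℝ) :
    ENNReal.ofReal (outputDensity μ s y).toReal = outputDensity μ s y :=
  ENNReal.ofReal_toReal (outputDensity_ne_top μ s y)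

lemma lintegral_outputDensity_mul (μ : Measure ℝ) [SFinite μ] (s : ℝ) {f : ℝ → ℝ≥0∞}
    (hf : Measurable f) :
    ∫⁻ y, outputDensity μ s y * f y = ∫⁻ x, (∫⁻ y, gaussianPDF (s * x) 1 y * f y) ∂μ := by
  have h1 : ∀ y, outputDensity μ s y * f y = ∫⁻ x, gaussianPDF (s * x) 1 y * f y ∂μ := fun y =>
    (lintegral_mul_const _ (measurable_gaussianPDF_left s 1 y)).symm
  rw [lintegral_congr h1]
  exact lintegral_lintegral_swap (((measurable_gaussianPDF_uncurry s 1).comp measurable_swap).mul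
    (hf.comp measurable_fst)).aemeasurable

lemma lintegral_outputDensity (μ : Measure ℝ) [IsProbabilityMeasure μ] (s : ℝ) :
    ∫⁻ y, outputDensity μ s y = 1 := by
  have h := lintegral_outputDensity_mul μ s (f := fun _ => 1) measurable_const
  simpa [fun x => lintegral_gaussianPDF_eq_one x (v := 1) one_ne_zero] using h

/-- The law of the input-output pair of the Gaussian channel. -/
lemma map_prod_gaussianReal (μ : Measure ℝ) [SFinite μ] (s : ℝ) :
    (μ.prod (gaussianReal 0 1)).map (fun p : ℝ × ℝ => (p.1, s * p.1 + p.2)) =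
      (μ.prod volume).withDensity fun p => gaussianPDF (s * p.1) 1 p.2 := by
  refine Measure.ext_of_lintegral _ fun f hf => ?_
  have hT : Measurable fun p : ℝ × ℝ => (p.1, s * p.1 + p.2) := by fun_prop
  have hfT : Measurable fun p : ℝ × ℝ => f (p.1, s * p.1 + p.2) := hf.comp hT
  rw [lintegral_map hf hT, lintegral_prod _ hfT.aemeasurable,
    lintegral_withDensity_eq_lintegral_mul _ (measurable_gaussianPDF_uncurry s 1) hf,
    lintegral_prod _ ((measurable_gaussianPDF_uncurry s 1).mul hf).aemeasurable]
  refine lintegral_congr fun x => ?_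
  have hx : Measurable fun y : ℝ => f (x, y) := hf.comp (measurable_const.prodMk measurable_id)
  have h2 : gaussianReal (s * x) 1 = (gaussianReal 0 1).map (s * x + ·) := by
    rw [gaussianReal_map_const_add]; simp
  calc ∫⁻ y, f (x, s * x + y) ∂gaussianReal 0 1
      = ∫⁻ y, f (x, y) ∂gaussianReal (s * x) 1 := by
        rw [h2, lintegral_map hx (by fun_prop)]
    _ = _ := by
        rw [gaussianReal_of_var_ne_zero _ one_ne_zero,
          lintegral_withDensity_eq_lintegral_mul _ (measurable_gaussianPDF _ _) hx]
        rfl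

/-- The law of the output of the Gaussian channel. -/
lemma map_add_gaussianReal (μ : Measure ℝ) [SFinite μ] (s : ℝ) :
    (μ.prod (gaussianReal 0 1)).map (fun p : ℝ × ℝ => s * p.1 + p.2) =
      volume.withDensity (outputDensity μ s) := by
  have hT : Measurable fun p : ℝ × ℝ => (p.1, s * p.1 + p.2) := by fun_prop
  have : (μ.prod (gaussianReal 0 1)).map (fun p : ℝ × ℝ => s * p.1 + p.2) =
      ((μ.prod (gaussianReal 0 1)).map (fun p : ℝ × ℝ => (p.1, s * p.1 + p.2))).map Prod.snd := by
    rw [Measure.map_map measurable_snd hT]; rfl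
  rw [this, map_prod_gaussianReal]
  refine Measure.ext_of_lintegral _ fun f hf => ?_
  have hf2 : Measurable fun p : ℝ × ℝ => f p.2 := hf.comp measurable_snd
  rw [lintegral_map hf measurable_snd,
    lintegral_withDensity_eq_lintegral_mul _ (measurable_gaussianPDF_uncurry s 1)
      hf2,
    lintegral_prod _ ((measurable_gaussianPDF_uncurry s 1).mul hf2).aemeasurable,
    lintegral_withDensity_eq_lintegral_mul _ (measurable_outputDensity μ s) hf]
  exact (lintegral_outputDensity_mul μ s hf).symm

/-! ### Mutual information as an average divergence -/

/-- The divergence of the output law given the input `x` from the output law. -/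
noncomputable def channelDiv (μ : Measure ℝ) (s x : ℝ) : ℝ≥0∞ :=
  ∫⁻ y, outputDensity μ s y * ENNReal.ofReal
    (InformationTheory.klFun (gaussianPDFReal (s * x) 1 y / (outputDensity μ s y).toReal))

/-- The mutual information, in nats, between the input and the output of the Gaussian channel. -/
noncomputable def channelInfo (μ : Measure ℝ) (s : ℝ) : ℝ≥0∞ := ∫⁻ x, channelDiv μ s x ∂μ

lemma measurable_channelDiv_integrand (μ : Measure ℝ) [SFinite μ] (s : ℝ) :
    Measurable fun p : ℝ × ℝ => outputDensity μ s p.2 * ENNReal.ofReal (InformationTheory.klFun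
      (gaussianPDFReal (s * p.1) 1 p.2 / (outputDensity μ s p.2).toReal)) := by
  have h1 : Measurable fun p : ℝ × ℝ => outputDensity μ s p.2 :=
    (measurable_outputDensity μ s).comp measurable_snd
  have h2 : Measurable fun p : ℝ × ℝ => gaussianPDFReal (s * p.1) 1 p.2 := by
    unfold gaussianPDFReal; fun_prop
  exact h1.mul (ENNReal.measurable_ofReal.comp
    (InformationTheory.measurable_klFun.comp (h2.div h1.ennreal_toReal)))

lemma measurable_channelDiv_section (μ : Measure ℝ) [SFinite μ] (s x : ℝ) :
    Measurable fun y => outputDensity μ s y * ENNReal.ofReal (InformationTheory.klFun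
      (gaussianPDFReal (s * x) 1 y / (outputDensity μ s y).toReal)) := by
  have h1 := measurable_outputDensity μ s
  exact h1.mul (ENNReal.measurable_ofReal.comp (InformationTheory.measurable_klFun.comp
    ((measurable_gaussianPDFReal _ _).div h1.ennreal_toReal)))

lemma measurable_channelDiv (μ : Measure ℝ) [SFinite μ] (s : ℝ) : Measurable (channelDiv μ s) :=
  (measurable_channelDiv_integrand μ s).lintegral_prod_right'

/-- The joint law has density kernel over output density with respect to the product of the
marginals. The output density is nowhere `0` or `⊤`, so this quotient can be formed and cancelled at
every point. -/
lemma klDiv_channel (μ : Measure ℝ) [IsProbabilityMeasure μ] (s : ℝ) :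
    InformationTheory.klDiv
      ((μ.prod (gaussianReal 0 1)).map (fun p : ℝ × ℝ => (p.1, s * p.1 + p.2)))
      (((μ.prod (gaussianReal 0 1)).map (fun p : ℝ × ℝ => p.1)).prod
        ((μ.prod (gaussianReal 0 1)).map (fun p : ℝ × ℝ => s * p.1 + p.2))) =
      channelInfo μ s := by
  have hfst : (μ.prod (gaussianReal 0 1)).map (fun p : ℝ × ℝ => p.1) = μ := by
    simp
  have hp : IsProbabilityMeasure (((μ.prod (gaussianReal 0 1)).map
      (fun p : ℝ × ℝ => (p.1, s * p.1 + p.2)))) :=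
    Measure.isProbabilityMeasure_map (by fun_prop)
  have hp' : IsProbabilityMeasure (((μ.prod (gaussianReal 0 1)).map
      (fun p : ℝ × ℝ => s * p.1 + p.2))) :=
    Measure.isProbabilityMeasure_map (by fun_prop)
  have hod := measurable_outputDensity μ s
  rw [map_prod_gaussianReal] at hp ⊢
  rw [map_add_gaussianReal] at hp' ⊢
  rw [hfst]
  have hprod : μ.prod (volume.withDensity (outputDensity μ s)) =
      (μ.prod volume).withDensity fun p => outputDensity μ s p.2 := prod_withDensity_right hod
  set r : ℝ × ℝ → ℝ≥0∞ := fun p => gaussianPDF (s * p.1) 1 p.2 / outputDensity μ s p.2 with hr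
  have hod2 : Measurable fun p : ℝ × ℝ => outputDensity μ s p.2 := hod.comp measurable_snd
  have hrm : Measurable r := (measurable_gaussianPDF_uncurry s 1).div hod2
  have hjoint : ((μ.prod volume).withDensity fun p : ℝ × ℝ => gaussianPDF (s * p.1) 1 p.2) =
      (μ.prod (volume.withDensity (outputDensity μ s))).withDensity r := by
    rw [hprod, ← withDensity_mul _ hod2 hrm]
    congr 1
    ext p
    simp only [hr, Pi.mul_apply]
    rw [ENNReal.mul_div_cancel (outputDensity_ne_zero μ s _) (outputDensity_ne_top μ s _)]
  rw [hjoint] at hp ⊢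
  rw [InformationTheory.klDiv_eq_lintegral_klFun_of_ac (withDensity_absolutelyContinuous _ _)]
  have hae := Measure.rnDeriv_withDensity (μ.prod (volume.withDensity (outputDensity μ s))) hrm
  have hkl : Measurable fun p => ENNReal.ofReal (InformationTheory.klFun (r p).toReal) :=
    ENNReal.measurable_ofReal.comp (InformationTheory.measurable_klFun.comp hrm.ennreal_toReal)
  rw [lintegral_congr_ae (g := fun p => ENNReal.ofReal (InformationTheory.klFun (r p).toReal))
    (by filter_upwards [hae] with p hp; rw [hp]), hprod,
    lintegral_withDensity_eq_lintegral_mul _ hod2 hkl, lintegral_prod _ (hod2.mul hkl).aemeasurable]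
  refine lintegral_congr fun x => lintegral_congr fun y => ?_
  simp [hr, ENNReal.toReal_div]

lemma gaussianChannelInfo_eq (b : ℝ) (μ : Measure ℝ) [IsProbabilityMeasure μ] (snr : ℝ) :
    gaussianChannelInfo b μ snr = channelInfo μ √snr / ENNReal.ofReal (Real.log b) := by
  unfold gaussianChannelInfo mutualInfo
  rw [klDiv_channel]

/-! ### Output entropy and divergence from a Gaussian -/

/-- The differential entropy of the output density relative to the constant density
`gaussianPeak`, as an integral of a nonnegative function. -/
noncomputable def outputEntropy (μ : Measure ℝ) (s : ℝ) : ℝ≥0∞ :=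
  ∫⁻ y, ENNReal.ofReal ((outputDensity μ s y).toReal *
    Real.log (gaussianPeak / (outputDensity μ s y).toReal))

/-- The second moment of a measure on the line. -/
noncomputable def secondMoment (μ : Measure ℝ) : ℝ≥0∞ := ∫⁻ x, ENNReal.ofReal (x ^ 2) ∂μ

/-- The divergence of the output law from a centered Gaussian. -/
noncomputable def outputDiv (v : NNReal) (μ : Measure ℝ) (s : ℝ) : ℝ≥0∞ :=
  ∫⁻ y, gaussianPDF 0 v y * ENNReal.ofReal
    (InformationTheory.klFun ((outputDensity μ s y).toReal / gaussianPDFReal 0 v y))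

lemma secondMoment_gaussianReal (m : ℝ) (v : NNReal) :
    secondMoment (gaussianReal m v) = ENNReal.ofReal (m ^ 2 + v) := by
  have hL : MemLp (fun x : ℝ => x) 2 (gaussianReal m v) := memLp_id_gaussianReal' 2 (by simp)
  unfold secondMoment
  rw [← ofReal_integral_eq_lintegral_ofReal hL.integrable_sq
    (Filter.Eventually.of_forall fun x => sq_nonneg x)]
  have h := variance_eq_sub hL
  rw [variance_fun_id_gaussianReal, integral_id_gaussianReal] at h
  congr 1
  simp only [Pi.pow_apply] at h
  linarith

lemma lintegral_gaussianPDF_mul_sq (m : ℝ) {v : NNReal} (hv : v ≠ 0) :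
    ∫⁻ y, gaussianPDF m v y * ENNReal.ofReal (y ^ 2) = ENNReal.ofReal (m ^ 2 + v) := by
  rw [← secondMoment_gaussianReal, secondMoment, gaussianReal_of_var_ne_zero _ hv,
    lintegral_withDensity_eq_lintegral_mul _ (measurable_gaussianPDF _ _) (by fun_prop)]
  rfl

lemma lintegral_gaussianPDF_mul_sub_sq (m : ℝ) :
    ∫⁻ y, gaussianPDF m 1 y * ENNReal.ofReal ((y - m) ^ 2) = 1 := by
  have h := lintegral_gaussianPDF_mul_sq 0 (v := 1) one_ne_zero
  rw [← lintegral_sub_right_eq_self _ m] at h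
  simp only [ne_eq, OfNat.ofNat_ne_zero, not_false_eq_true, zero_pow, NNReal.coe_one, zero_add,
    ENNReal.ofReal_one] at h
  rw [← h]
  refine lintegral_congr fun y => ?_
  congr 1
  unfold gaussianPDF gaussianPDFReal
  simp

lemma klFun_div_mul {p q : ℝ} (hq : 0 < q) :
    q * InformationTheory.klFun (p / q) = p * Real.log (p / q) + q - p := by
  rw [InformationTheory.klFun_apply]
  field_simp

lemma measurable_outputDensity_log (μ : Measure ℝ) [SFinite μ] (s : ℝ) : Measurable fun y =>
    ENNReal.ofReal (Real.log (gaussianPeak / (outputDensity μ s y).toReal)) := by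
  have := (measurable_outputDensity μ s).ennreal_toReal
  fun_prop

lemma log_gaussianPeak_div_nonneg (μ : Measure ℝ) [IsProbabilityMeasure μ] (s y : ℝ) :
    0 ≤ Real.log (gaussianPeak / (outputDensity μ s y).toReal) :=
  Real.log_nonneg ((one_le_div (outputDensity_toReal_pos μ s y)).2 (outputDensity_toReal_le μ s y))

/-- The log of the kernel is the log of its peak minus `(y - s x)² / 2`, and integrating this square
against the kernel gives the `1/2`. The pointwise identity has all negative terms moved across, so
that only nonnegative functions are integrated and no integrability is needed. -/
lemma channelDiv_add_half (μ : Measure ℝ) [IsProbabilityMeasure μ] (s x : ℝ) :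
    channelDiv μ s x + ENNReal.ofReal (1 / 2) = ∫⁻ y, gaussianPDF (s * x) 1 y *
      ENNReal.ofReal (Real.log (gaussianPeak / (outputDensity μ s y).toReal)) := by
  have hpt : ∀ y, outputDensity μ s y * ENNReal.ofReal (InformationTheory.klFun
        (gaussianPDFReal (s * x) 1 y / (outputDensity μ s y).toReal)) +
      (ENNReal.ofReal (1 / 2) * (gaussianPDF (s * x) 1 y * ENNReal.ofReal ((y - s * x) ^ 2)) +
        gaussianPDF (s * x) 1 y) =
      gaussianPDF (s * x) 1 y *
        ENNReal.ofReal (Real.log (gaussianPeak / (outputDensity μ s y).toReal)) +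
      outputDensity μ s y := by
    intro y
    have h0 := outputDensity_toReal_pos μ s y
    have h1 := gaussianPDFReal_pos (s * x) 1 y one_ne_zero
    have h2 := log_gaussianPeak_div_nonneg μ s y
    have h3 := InformationTheory.klFun_nonneg (div_pos h1 h0).le
    have h4 := klFun_div_mul (p := gaussianPDFReal (s * x) 1 y) h0
    have h5 : Real.log (gaussianPDFReal (s * x) 1 y / (outputDensity μ s y).toReal) =
        Real.log (gaussianPeak / (outputDensity μ s y).toReal) - (y - s * x) ^ 2 / 2 := by
      rw [gaussianPDFReal_one_eq, mul_div_right_comm, Real.log_mul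
        (div_pos gaussianPeak_pos h0).ne' (Real.exp_pos _).ne', Real.log_exp]
      ring
    rw [← ofReal_outputDensity_toReal μ s y]
    unfold gaussianPDF
    rw [ENNReal.toReal_ofReal h0.le]
    rw [← ENNReal.ofReal_mul h0.le, ← ENNReal.ofReal_mul h1.le, ← ENNReal.ofReal_mul h1.le,
      ← ENNReal.ofReal_mul (by norm_num), ← ENNReal.ofReal_add (by positivity) h1.le,
      ← ENNReal.ofReal_add (by positivity) (by positivity),
      ← ENNReal.ofReal_add (by positivity) h0.le, h4, h5]
    congr 1
    ring
  have hm1 : Measurable fun y => gaussianPDF (s * x) 1 y := measurable_gaussianPDF _ _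
  have hm2 : Measurable fun y => gaussianPDF (s * x) 1 y * ENNReal.ofReal ((y - s * x) ^ 2) := by
    fun_prop
  have hm3 : Measurable fun y => gaussianPDF (s * x) 1 y *
        ENNReal.ofReal (Real.log (gaussianPeak / (outputDensity μ s y).toReal)) :=
    hm1.mul (measurable_outputDensity_log μ s)
  have h := lintegral_congr (μ := volume) hpt
  simp_rw [← add_assoc] at h
  rw [lintegral_add_right _ hm1, lintegral_add_right _ (hm2.const_mul _),
    lintegral_const_mul _ hm2, lintegral_gaussianPDF_mul_sub_sq,
    lintegral_gaussianPDF_eq_one _ one_ne_zero, lintegral_add_left hm3, lintegral_outputDensity,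
    mul_one] at h
  exact (ENNReal.add_left_inj ENNReal.one_ne_top).1 h

/-- This is `I(X; Y) = h(Y) - h(Z)`: averaging the kernel over the input turns the cross term of
`channelDiv_add_half` into the entropy of the output density. -/
lemma channelInfo_add_half (μ : Measure ℝ) [IsProbabilityMeasure μ] (s : ℝ) :
    channelInfo μ s + ENNReal.ofReal (1 / 2) = outputEntropy μ s := by
  have h : ∫⁻ x, (channelDiv μ s x + ENNReal.ofReal (1 / 2)) ∂μ = outputEntropy μ s := by
    rw [lintegral_congr fun x => channelDiv_add_half μ s x,
      ← lintegral_outputDensity_mul μ s (measurable_outputDensity_log μ s)]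
    refine lintegral_congr fun y => ?_
    rw [ENNReal.ofReal_mul ENNReal.toReal_nonneg, ofReal_outputDensity_toReal]
  rw [← h, lintegral_add_right _ measurable_const]
  simp [channelInfo]

lemma lintegral_outputDensity_mul_sq (μ : Measure ℝ) [IsProbabilityMeasure μ] (s : ℝ) :
    ∫⁻ y, outputDensity μ s y * ENNReal.ofReal (y ^ 2) =
      1 + ENNReal.ofReal (s ^ 2) * secondMoment μ := by
  rw [lintegral_outputDensity_mul μ s (by fun_prop)]
  simp_rw [fun x => lintegral_gaussianPDF_mul_sq (s * x) (v := 1) one_ne_zero]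
  rw [secondMoment, ← lintegral_const_mul _ (by fun_prop), add_comm]
  have : ∀ x : ℝ, ENNReal.ofReal ((s * x) ^ 2 + (1 : NNReal)) =
      ENNReal.ofReal (s ^ 2) * ENNReal.ofReal (x ^ 2) + 1 := fun x => by
    rw [ENNReal.ofReal_add (by positivity) (by positivity), mul_pow,
      ENNReal.ofReal_mul (by positivity)]
    simp
  rw [lintegral_congr this, lintegral_add_right _ measurable_const]
  simp

/-- The log density of `N(0, v)` is quadratic, so its mean under the output law only sees the second
moment. The condition `1 ≤ v` keeps `log v` nonnegative, so that `ENNReal.ofReal` does not truncate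
it. -/
lemma outputEntropy_add_outputDiv (μ : Measure ℝ) [IsProbabilityMeasure μ] (s : ℝ) {v : NNReal}
    (hv : 1 ≤ v) :
    outputEntropy μ s + outputDiv v μ s = ENNReal.ofReal (Real.log v / 2) +
      ENNReal.ofReal (1 / (2 * v)) * (1 + ENNReal.ofReal (s ^ 2) * secondMoment μ) := by
  have hv0 : v ≠ 0 := (zero_lt_one.trans_le hv).ne'
  have hvr : (1 : ℝ) ≤ v := by exact_mod_cast hv
  have hv' : (0 : ℝ) < v := zero_lt_one.trans_le hvr
  have hlogv : 0 ≤ Real.log v := Real.log_nonneg hvr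
  have hpt : ∀ y, ENNReal.ofReal ((outputDensity μ s y).toReal *
        Real.log (gaussianPeak / (outputDensity μ s y).toReal)) +
      (gaussianPDF 0 v y * ENNReal.ofReal (InformationTheory.klFun
        ((outputDensity μ s y).toReal / gaussianPDFReal 0 v y)) + outputDensity μ s y) =
      ENNReal.ofReal (Real.log v / 2) * outputDensity μ s y +
        (ENNReal.ofReal (1 / (2 * v)) * (outputDensity μ s y * ENNReal.ofReal (y ^ 2)) +
        gaussianPDF 0 v y) := by
    intro y
    have h0 := outputDensity_toReal_pos μ s y
    have h1 := gaussianPDFReal_pos 0 v y hv0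
    have h2 := log_gaussianPeak_div_nonneg μ s y
    have h3 := InformationTheory.klFun_nonneg (div_pos h0 h1).le
    have h4 := klFun_div_mul (p := (outputDensity μ s y).toReal) h1
    have h6 : Real.log (gaussianPDFReal 0 v y) =
        Real.log gaussianPeak - Real.log v / 2 - y ^ 2 / (2 * v) := by
      have : gaussianPDFReal 0 v y =
          gaussianPeak * ((√v)⁻¹ * Real.exp (-y ^ 2 / (2 * v))) := by
        unfold gaussianPDFReal gaussianPeak
        rw [Real.sqrt_mul (by positivity) (v : ℝ), sub_zero, mul_inv, mul_assoc]
      rw [this, Real.log_mul gaussianPeak_pos.ne' (by positivity),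
        Real.log_mul (by positivity) (by positivity), Real.log_exp, Real.log_inv,
        Real.log_sqrt hv'.le]
      ring
    have h5 : Real.log ((outputDensity μ s y).toReal / gaussianPDFReal 0 v y) =
        -Real.log (gaussianPeak / (outputDensity μ s y).toReal) + Real.log v / 2 +
          y ^ 2 / (2 * v) := by
      rw [Real.log_div h0.ne' h1.ne', h6, Real.log_div gaussianPeak_pos.ne' h0.ne']
      ring
    rw [← ofReal_outputDensity_toReal μ s y]
    unfold gaussianPDF
    rw [ENNReal.toReal_ofReal h0.le]
    rw [← ENNReal.ofReal_mul h0.le, ← ENNReal.ofReal_mul h1.le,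
      ← ENNReal.ofReal_mul (by positivity), ← ENNReal.ofReal_mul (by positivity),
      ← ENNReal.ofReal_add (by positivity) h0.le, ← ENNReal.ofReal_add (by positivity) h1.le,
      ← ENNReal.ofReal_add (by positivity) (by positivity),
      ← ENNReal.ofReal_add (by positivity) (by positivity), h4, h5]
    congr 1
    ring
  have hod := measurable_outputDensity μ s
  have hm1 : Measurable fun y => outputDensity μ s y * ENNReal.ofReal (y ^ 2) := by fun_prop
  have hm2 : Measurable fun y => gaussianPDF 0 v y * ENNReal.ofReal (InformationTheory.klFun
        ((outputDensity μ s y).toReal / gaussianPDFReal 0 v y)) :=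
    (measurable_gaussianPDF _ _).mul (ENNReal.measurable_ofReal.comp
      (InformationTheory.measurable_klFun.comp
        (hod.ennreal_toReal.div (measurable_gaussianPDFReal _ _))))
  have h := lintegral_congr (μ := volume) hpt
  simp_rw [← add_assoc] at h
  rw [lintegral_add_right _ hod, lintegral_add_right _ hm2,
    lintegral_add_right _ (measurable_gaussianPDF _ _),
    lintegral_add_left (hod.const_mul _), lintegral_const_mul _ hod, lintegral_const_mul _ hm1,
    lintegral_gaussianPDF_eq_one _ hv0, lintegral_outputDensity, lintegral_outputDensity_mul_sq,
    mul_one] at h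
  exact (ENNReal.add_left_inj ENNReal.one_ne_top).1 h

lemma outputEntropy_ne_top {μ : Measure ℝ} [IsProbabilityMeasure μ] (s : ℝ)
    (hμ : secondMoment μ ≠ ⊤) : outputEntropy μ s ≠ ⊤ := by
  have h := outputEntropy_add_outputDiv μ s le_rfl
  refine ne_top_of_le_ne_top ?_ (h ▸ le_self_add)
  finiteness

lemma outputDiv_ne_top {μ : Measure ℝ} [IsProbabilityMeasure μ] (s : ℝ) {v : NNReal} (hv : 1 ≤ v)
    (hμ : secondMoment μ ≠ ⊤) : outputDiv v μ s ≠ ⊤ := by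
  have h := outputEntropy_add_outputDiv μ s hv
  refine ne_top_of_le_ne_top ?_ (h ▸ le_add_self)
  finiteness

lemma channelInfo_ne_top {μ : Measure ℝ} [IsProbabilityMeasure μ] (s : ℝ)
    (hμ : secondMoment μ ≠ ⊤) : channelInfo μ s ≠ ⊤ :=
  ne_top_of_le_ne_top (outputEntropy_ne_top s hμ) (channelInfo_add_half μ s ▸ le_self_add)

lemma channelInfo_le_of_outputEntropy_le {μ ν : Measure ℝ} [IsProbabilityMeasure μ]
    [IsProbabilityMeasure ν] {s : ℝ} (h : outputEntropy μ s ≤ outputEntropy ν s) :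
    channelInfo μ s ≤ channelInfo ν s := by
  rw [← channelInfo_add_half, ← channelInfo_add_half] at h
  exact (ENNReal.add_le_add_iff_right ENNReal.ofReal_ne_top).1 h

lemma channelInfo_lt_of_outputEntropy_lt {μ ν : Measure ℝ} [IsProbabilityMeasure μ]
    [IsProbabilityMeasure ν] {s : ℝ} (h : outputEntropy μ s < outputEntropy ν s) :
    channelInfo μ s < channelInfo ν s := by
  rw [← channelInfo_add_half, ← channelInfo_add_half] at h
  exact (ENNReal.add_lt_add_iff_right ENNReal.ofReal_ne_top).1 h

/-! ### Strict Jensen inequality and degraded channels -/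

/-- Strict Jensen inequality for `klFun`, in terms of lower Lebesgue integrals. -/
lemma ae_eq_const_or_klFun_integral_lt {α : Type*} [MeasurableSpace α] {κ : Measure α}
    [IsProbabilityMeasure κ] {f : α → ℝ} (hf : Measurable f) (hf0 : ∀ z, 0 ≤ f z)
    (hfi : Integrable f κ) :
    f =ᵐ[κ] Function.const α (∫ z, f z ∂κ) ∨
      ENNReal.ofReal (InformationTheory.klFun (∫ z, f z ∂κ)) <
        ∫⁻ z, ENNReal.ofReal (InformationTheory.klFun (f z)) ∂κ := by
  by_cases htop : ∫⁻ z, ENNReal.ofReal (InformationTheory.klFun (f z)) ∂κ = ⊤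
  · exact Or.inr (htop ▸ ENNReal.ofReal_lt_top)
  have h0 : ∀ z, 0 ≤ InformationTheory.klFun (f z) :=
    fun z => InformationTheory.klFun_nonneg (hf0 z)
  have hm : Measurable fun z => InformationTheory.klFun (f z) :=
    InformationTheory.measurable_klFun.comp hf
  have hgi : Integrable (fun z => InformationTheory.klFun (f z)) κ := by
    refine ⟨hm.aestronglyMeasurable, ?_⟩
    rw [hasFiniteIntegral_iff_ofReal (Filter.Eventually.of_forall h0)]
    exact lt_top_iff_ne_top.2 htop
  have h := InformationTheory.strictConvexOn_klFun.ae_eq_const_or_map_average_lt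
    InformationTheory.continuous_klFun.continuousOn isClosed_Ici
    (Filter.Eventually.of_forall hf0) hfi hgi
  rw [average_eq_integral, average_eq_integral] at h
  refine h.imp_right fun h => ?_
  rw [← ofReal_integral_eq_lintegral_ofReal hgi (Filter.Eventually.of_forall h0)]
  refine (ENNReal.ofReal_lt_ofReal_iff_of_nonneg ?_).2 h
  exact InformationTheory.klFun_nonneg (integral_nonneg hf0)

lemma klFun_integral_le {α : Type*} [MeasurableSpace α] {κ : Measure α}
    [IsProbabilityMeasure κ] {f : α → ℝ} (hf : Measurable f) (hf0 : ∀ z, 0 ≤ f z)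
    (hfi : Integrable f κ) :
    ENNReal.ofReal (InformationTheory.klFun (∫ z, f z ∂κ)) ≤
      ∫⁻ z, ENNReal.ofReal (InformationTheory.klFun (f z)) ∂κ := by
  rcases ae_eq_const_or_klFun_integral_lt hf hf0 hfi with h | h
  · have h2 : (fun z => ENNReal.ofReal (InformationTheory.klFun (f z))) =ᵐ[κ]
        fun _ => ENNReal.ofReal (InformationTheory.klFun (∫ z, f z ∂κ)) := by
      filter_upwards [h] with z hz
      rw [hz, Function.const_apply]
    rw [lintegral_congr_ae h2]
    simp
  · exact h.le

/-- Bayes' rule for a Gaussian pair: if `z` has law `N(m, 1)` and `y` is `c z` plus noise of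
variance `1 - c²`, then `y` again has unit variance, and `z` given `y` is Gaussian. -/
lemma gaussianPDF_mul_gaussianPDF (c m y z : ℝ) {v : NNReal} (hv : (v : ℝ) = 1 - c ^ 2)
    (hv0 : v ≠ 0) :
    gaussianPDF m 1 z * gaussianPDF (c * z) v y =
      gaussianPDF (c * m) 1 y * gaussianPDF (m + c * (y - c * m)) v z := by
  have hv' : (v : ℝ) ≠ 0 := by exact_mod_cast hv0
  unfold gaussianPDF
  rw [← ENNReal.ofReal_mul (gaussianPDFReal_nonneg _ _ _),
    ← ENNReal.ofReal_mul (gaussianPDFReal_nonneg _ _ _), gaussianPDFReal_one_eq,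
    gaussianPDFReal_one_eq]
  unfold gaussianPDFReal
  congr 1
  have h : Real.exp (-(z - m) ^ 2 / 2) * Real.exp (-(y - c * z) ^ 2 / (2 * v)) =
      Real.exp (-(y - c * m) ^ 2 / 2) *
        Real.exp (-(z - (m + c * (y - c * m))) ^ 2 / (2 * v)) := by
    rw [← Real.exp_add, ← Real.exp_add]
    congr 1
    field_simp
    rw [hv]
    ring
  linear_combination gaussianPeak * (√(2 * Real.pi * v))⁻¹ * h

section Degraded

variable {μ : Measure ℝ} [IsProbabilityMeasure μ] {c s : ℝ} {v : NNReal}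

lemma lintegral_gaussianPDF_degraded (hv : (v : ℝ) = 1 - c ^ 2) (hv0 : v ≠ 0) (x y : ℝ) :
    ∫⁻ z, gaussianPDF (s * x) 1 z * gaussianPDF (c * z) v y = gaussianPDF (c * s * x) 1 y := by
  rw [lintegral_congr fun z => gaussianPDF_mul_gaussianPDF c (s * x) y z hv hv0,
    lintegral_const_mul _ (measurable_gaussianPDF _ _), lintegral_gaussianPDF_eq_one _ hv0,
    mul_one, mul_assoc]

lemma lintegral_outputDensity_degraded (hv : (v : ℝ) = 1 - c ^ 2) (hv0 : v ≠ 0) (y : ℝ) :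
    ∫⁻ z, outputDensity μ s z * gaussianPDF (c * z) v y = outputDensity μ (c * s) y := by
  rw [lintegral_outputDensity_mul μ s (measurable_gaussianPDF_left c v y)]
  exact lintegral_congr fun x => lintegral_gaussianPDF_degraded hv hv0 x y

/-- Both densities integrate to one, so the factor must be `1`. This settles the equality case of
Jensen. -/
lemma channelDiv_eq_zero_of_proportional {x t : ℝ} (h : ∀ᵐ z,
    gaussianPDFReal (s * x) 1 z / (outputDensity μ s z).toReal = t) :
    channelDiv μ s x = 0 := by
  have h1 : ∀ᵐ z, gaussianPDF (s * x) 1 z = ENNReal.ofReal t * outputDensity μ s z := by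
    filter_upwards [h] with z hz
    have h0 := outputDensity_toReal_pos μ s z
    rw [div_eq_iff h0.ne'] at hz
    have ht : 0 ≤ t := by
      by_contra hneg
      have := gaussianPDFReal_nonneg (s * x) 1 z
      nlinarith
    rw [gaussianPDF, hz, ENNReal.ofReal_mul ht, ofReal_outputDensity_toReal]
  have h2 := lintegral_congr_ae h1
  rw [lintegral_gaussianPDF_eq_one _ one_ne_zero,
    lintegral_const_mul _ (measurable_outputDensity μ s), lintegral_outputDensity, mul_one] at h2
  have ht : t = 1 := by rw [eq_comm, ENNReal.ofReal_eq_one] at h2; exact h2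
  unfold channelDiv
  rw [lintegral_eq_zero_iff (measurable_channelDiv_section μ s x)]
  filter_upwards [h] with z hz
  simp [hz, ht, InformationTheory.klFun_one]

/-- Data processing at a fixed output `y` of the weaker channel: its likelihood ratio is the
conditional mean, given `y`, of the likelihood ratio of the stronger channel, and `klFun` is
strictly convex. -/
lemma degraded_integrand_le_and_lt (hv : (v : ℝ) = 1 - c ^ 2) (hv0 : v ≠ 0) (x y : ℝ) :
    (outputDensity μ (c * s) y * ENNReal.ofReal (InformationTheory.klFun
        (gaussianPDFReal (c * s * x) 1 y / (outputDensity μ (c * s) y).toReal)) ≤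
      ∫⁻ z, outputDensity μ s z * gaussianPDF (c * z) v y * ENNReal.ofReal
        (InformationTheory.klFun (gaussianPDFReal (s * x) 1 z / (outputDensity μ s z).toReal))) ∧
    (channelDiv μ s x ≠ 0 → outputDensity μ (c * s) y * ENNReal.ofReal (InformationTheory.klFun
        (gaussianPDFReal (c * s * x) 1 y / (outputDensity μ (c * s) y).toReal)) <
      ∫⁻ z, outputDensity μ s z * gaussianPDF (c * z) v y * ENNReal.ofReal
        (InformationTheory.klFun
          (gaussianPDFReal (s * x) 1 z / (outputDensity μ s z).toReal))) := by
  have hod := measurable_outputDensity μ s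
  have hψ := measurable_gaussianPDF_left c v y
  set d := outputDensity μ (c * s) y with hd
  have hd0 : d ≠ 0 := outputDensity_ne_zero μ _ y
  have hdt : d ≠ ⊤ := outputDensity_ne_top μ _ y
  -- `g` is the conditional density of the stronger output `z` given the weaker output `y`.
  set g : ℝ → ℝ≥0∞ := fun z => d⁻¹ * (outputDensity μ s z * gaussianPDF (c * z) v y) with hg
  have hgm : Measurable g := (hod.mul hψ).const_mul _
  set κ : Measure ℝ := volume.withDensity g with hκ
  have hκp : IsProbabilityMeasure κ := by
    constructor
    rw [hκ, withDensity_apply _ MeasurableSet.univ, setLIntegral_univ,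
      hg, lintegral_const_mul' _ _ (ENNReal.inv_ne_top.2 hd0), lintegral_outputDensity_degraded hv hv0,
      ENNReal.inv_mul_cancel hd0 hdt]
  set f : ℝ → ℝ := fun z => gaussianPDFReal (s * x) 1 z / (outputDensity μ s z).toReal with hf
  have hfm : Measurable f := (measurable_gaussianPDFReal _ _).div hod.ennreal_toReal
  have hf0 : ∀ z, 0 ≤ f z := fun z => div_nonneg (gaussianPDFReal_nonneg _ _ _) ENNReal.toReal_nonneg
  have hfl : ∫⁻ z, ENNReal.ofReal (f z) ∂κ = gaussianPDF (c * s * x) 1 y / d := by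
    rw [hκ, lintegral_withDensity_eq_lintegral_mul _ hgm hfm.ennreal_ofReal]
    have : ∀ z, (g * fun z => ENNReal.ofReal (f z)) z =
        d⁻¹ * (gaussianPDF (s * x) 1 z * gaussianPDF (c * z) v y) := by
      intro z
      have hz0 := outputDensity_ne_zero μ s z
      have hzt := outputDensity_ne_top μ s z
      have : ENNReal.ofReal (f z) = gaussianPDF (s * x) 1 z / outputDensity μ s z := by
        rw [hf, ENNReal.ofReal_div_of_pos (outputDensity_toReal_pos μ s z),
          ofReal_outputDensity_toReal, gaussianPDF]
      rw [Pi.mul_apply, this, hg]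
      simp only
      rw [mul_assoc, mul_right_comm, ENNReal.mul_div_cancel hz0 hzt]
    rw [lintegral_congr this, lintegral_const_mul' _ _ (ENNReal.inv_ne_top.2 hd0),
      lintegral_gaussianPDF_degraded hv hv0, mul_comm, ENNReal.div_eq_inv_mul, mul_comm]
  have hfi : Integrable f κ := by
    refine ⟨hfm.aestronglyMeasurable, ?_⟩
    rw [hasFiniteIntegral_iff_ofReal (Filter.Eventually.of_forall hf0), hfl]
    exact ENNReal.div_lt_top gaussianPDF_ne_top hd0
  have hfI : ∫ z, f z ∂κ = gaussianPDFReal (c * s * x) 1 y / d.toReal := by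
    rw [integral_eq_lintegral_of_nonneg_ae (Filter.Eventually.of_forall hf0)
      hfm.aestronglyMeasurable, hfl, ENNReal.toReal_div, toReal_gaussianPDF]
  have hkm : Measurable fun z => ENNReal.ofReal (InformationTheory.klFun (f z)) :=
    (InformationTheory.measurable_klFun.comp hfm).ennreal_ofReal
  have hB : d * ∫⁻ z, ENNReal.ofReal (InformationTheory.klFun (f z)) ∂κ =
      ∫⁻ z, outputDensity μ s z * gaussianPDF (c * z) v y *
        ENNReal.ofReal (InformationTheory.klFun (f z)) := by
    have h2 : ∀ z, (g * fun z => ENNReal.ofReal (InformationTheory.klFun (f z))) z =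
        d⁻¹ * (outputDensity μ s z * gaussianPDF (c * z) v y *
          ENNReal.ofReal (InformationTheory.klFun (f z))) := fun z => mul_assoc _ _ _
    rw [hκ, lintegral_withDensity_eq_lintegral_mul _ hgm hkm, lintegral_congr h2,
      lintegral_const_mul' _ _ (ENNReal.inv_ne_top.2 hd0), ← mul_assoc, ENNReal.mul_inv_cancel hd0 hdt,
      one_mul]
  rw [← hfI, ← hB]
  refine ⟨mul_le_mul_right (klFun_integral_le hfm hf0 hfi) _, fun hne => ?_⟩
  refine ENNReal.mul_lt_mul_right hd0 hdt
    ((ae_eq_const_or_klFun_integral_lt hfm hf0 hfi).resolve_left fun h => hne ?_)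
  -- The conditional density vanishes nowhere, so a ratio that is constant `κ`-a.e. is constant
  -- Lebesgue-a.e.
  have hac : volume ≪ κ := withDensity_absolutelyContinuous' hgm.aemeasurable
    (Filter.Eventually.of_forall fun z => mul_ne_zero (ENNReal.inv_ne_zero.2 hdt)
      (mul_ne_zero (outputDensity_ne_zero μ s z) (gaussianPDF_pos _ hv0 _).ne'))
  exact channelDiv_eq_zero_of_proportional (hac h)

lemma lintegral_degraded_integrand (hv0 : v ≠ 0) (x : ℝ) :
    ∫⁻ y, (∫⁻ z, outputDensity μ s z * gaussianPDF (c * z) v y * ENNReal.ofReal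
      (InformationTheory.klFun (gaussianPDFReal (s * x) 1 z / (outputDensity μ s z).toReal))) =
      channelDiv μ s x := by
  have hm := measurable_channelDiv_section μ s x
  have h1 : ∀ y z, outputDensity μ s z * gaussianPDF (c * z) v y * ENNReal.ofReal
      (InformationTheory.klFun (gaussianPDFReal (s * x) 1 z / (outputDensity μ s z).toReal)) =
      outputDensity μ s z * ENNReal.ofReal
      (InformationTheory.klFun (gaussianPDFReal (s * x) 1 z / (outputDensity μ s z).toReal)) *
        gaussianPDF (c * z) v y := fun y z => mul_right_comm _ _ _
  simp_rw [h1]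
  rw [lintegral_lintegral_swap (((hm.comp measurable_snd).mul
    ((measurable_gaussianPDF_uncurry c v).comp measurable_swap)).aemeasurable)]
  refine lintegral_congr fun z => ?_
  rw [lintegral_const_mul _ (measurable_gaussianPDF _ _), lintegral_gaussianPDF_eq_one _ hv0,
    mul_one]

lemma channelDiv_degraded_le (hv : (v : ℝ) = 1 - c ^ 2) (hv0 : v ≠ 0) (x : ℝ) :
    channelDiv μ (c * s) x ≤ channelDiv μ s x := by
  rw [← lintegral_degraded_integrand (s := s) hv0 x (c := c)]
  exact lintegral_mono fun y => (degraded_integrand_le_and_lt hv hv0 x y).1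

lemma channelDiv_degraded_lt (hv : (v : ℝ) = 1 - c ^ 2) (hv0 : v ≠ 0) {x : ℝ}
    (hx0 : channelDiv μ s x ≠ 0) (hxt : channelDiv μ s x ≠ ⊤) :
    channelDiv μ (c * s) x < channelDiv μ s x := by
  have h := fun y => (degraded_integrand_le_and_lt (μ := μ) (s := s) hv hv0 x y).2 hx0
  rw [← lintegral_degraded_integrand (s := s) hv0 x (c := c)] at hxt ⊢
  rw [channelDiv]
  refine lintegral_strict_mono (NeZero.ne _) ?_ ?_ (Filter.Eventually.of_forall h)
  · refine (Measurable.lintegral_prod_left' (f := fun p : ℝ × ℝ => outputDensity μ s p.1 *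
      gaussianPDF (c * p.1) v p.2 * ENNReal.ofReal (InformationTheory.klFun
        (gaussianPDFReal (s * x) 1 p.1 / (outputDensity μ s p.1).toReal))) ?_).aemeasurable
    have hod : Measurable fun p : ℝ × ℝ => outputDensity μ s p.1 :=
      (measurable_outputDensity μ s).comp measurable_fst
    refine (hod.mul (measurable_gaussianPDF_uncurry c v)).mul
      (InformationTheory.measurable_klFun.comp (Measurable.div ?_ hod.ennreal_toReal)).ennreal_ofReal
    exact (measurable_gaussianPDFReal _ _).comp measurable_fst
  · exact ne_top_of_le_ne_top hxt (lintegral_mono fun y => (h y).le)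

lemma exists_noiseVariance (hc : c ^ 2 < 1) : ∃ v : NNReal, (v : ℝ) = 1 - c ^ 2 ∧ v ≠ 0 := by
  refine ⟨⟨1 - c ^ 2, by linarith⟩, rfl, fun h => ?_⟩
  have : 1 - c ^ 2 = 0 := congrArg NNReal.toReal h
  linarith

lemma channelInfo_degraded_le (hc : c ^ 2 < 1) : channelInfo μ (c * s) ≤ channelInfo μ s := by
  obtain ⟨v, hv, hv0⟩ := exists_noiseVariance hc
  exact lintegral_mono fun x => channelDiv_degraded_le hv hv0 x

lemma channelInfo_degraded_lt (hc : c ^ 2 < 1) (hI0 : channelInfo μ s ≠ 0)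
    (hIt : channelInfo μ s ≠ ⊤) : channelInfo μ (c * s) < channelInfo μ s := by
  obtain ⟨v, hv, hv0⟩ := exists_noiseVariance hc
  have hfin : ∀ᵐ x ∂μ, channelDiv μ s x < ⊤ := ae_lt_top (measurable_channelDiv μ s) hIt
  have hle : ∀ x, channelDiv μ (c * s) x ≤ channelDiv μ s x := channelDiv_degraded_le hv hv0
  have hpos : ∃ᵐ x ∂μ, channelDiv μ s x ≠ 0 := fun h => hI0 <| by
    rw [channelInfo, lintegral_eq_zero_iff (measurable_channelDiv μ s)]
    filter_upwards [h] with x hx using not_not.1 hx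
  exact lintegral_strict_mono_of_ae_le_of_frequently_ae_lt (measurable_channelDiv μ s).aemeasurable
    (ne_top_of_le_ne_top hIt (lintegral_mono hle)) (Filter.Eventually.of_forall hle)
    ((hpos.and_eventually hfin).mono fun x hx => (channelDiv_degraded_lt hv hv0 hx.1 hx.2.ne).ne)

end Degraded

/-! ### Affine changes of the input and standardization -/

lemma outputDensity_map_affine (μ : Measure ℝ) (s a m y : ℝ) :
    outputDensity (μ.map fun x => a * (x - m)) s y = outputDensity μ (a * s) (y + a * s * m) := by
  unfold outputDensity
  rw [lintegral_map (measurable_gaussianPDF_left s 1 y) (by fun_prop)]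
  refine lintegral_congr fun x => ?_
  unfold gaussianPDF gaussianPDFReal
  congr 3
  ring_nf

/-- Scaling the input is absorbed in the gain, and shifting it translates the output density, which
leaves `outputEntropy` unchanged. -/
lemma channelInfo_map_affine (μ : Measure ℝ) [IsProbabilityMeasure μ] (s a m : ℝ) :
    channelInfo (μ.map fun x => a * (x - m)) s = channelInfo μ (a * s) := by
  have : IsProbabilityMeasure (μ.map fun x => a * (x - m)) :=
    Measure.isProbabilityMeasure_map (by fun_prop)
  refine (ENNReal.add_left_inj (ENNReal.ofReal_ne_top (r := 1 / 2))).1 ?_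
  rw [channelInfo_add_half, channelInfo_add_half]
  unfold outputEntropy
  simp_rw [outputDensity_map_affine]
  exact lintegral_add_right_eq_self (fun y => ENNReal.ofReal ((outputDensity μ (a * s) y).toReal *
    Real.log (gaussianPeak / (outputDensity μ (a * s) y).toReal))) _

lemma entropy_map_le (b : ℝ) (μ : Measure ℝ) {f : ℝ → ℝ} (hf : Measurable f)
    (hinj : Function.Bijective f) : entropy b (μ.map f) ≤ entropy b μ := by
  have hemb : MeasurableEmbedding f := hf.measurableEmbedding hinj.1
  unfold entropy
  by_cases h : ∃ S : Set ℝ, S.Countable ∧ μ Sᶜ = 0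
  · obtain ⟨S, hS, hμS⟩ := h
    have hS' : (μ.map f) (f '' S)ᶜ = 0 := by
      rw [hemb.map_apply, Set.preimage_compl, Set.preimage_image_eq _ hinj.1, hμS]
    rw [if_pos ⟨f '' S, hS.image f, hS'⟩, if_pos ⟨S, hS, hμS⟩]
    · refine le_of_eq ?_
      rw [← (Equiv.ofBijective f hinj).tsum_eq]
      refine tsum_congr fun x => ?_
      have : (μ.map f).real {f x} = μ.real {x} := by
        rw [measureReal_def, hemb.map_apply, measureReal_def, ← Set.image_singleton,
          Set.preimage_image_eq _ hinj.1]
      simp [this]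
  · rw [if_neg h]
    exact le_top

lemma memLp_of_secondMoment_ne_top {μ : Measure ℝ} (h : secondMoment μ ≠ ⊤) :
    MemLp (fun x : ℝ => x) 2 μ := by
  rw [memLp_two_iff_integrable_sq (by fun_prop)]
  refine ⟨by fun_prop, ?_⟩
  rw [hasFiniteIntegral_iff_ofReal (Filter.Eventually.of_forall fun x => sq_nonneg x)]
  exact lt_top_iff_ne_top.2 h

lemma secondMoment_eq_ofReal_integral {μ : Measure ℝ} (h : secondMoment μ ≠ ⊤) :
    secondMoment μ = ENNReal.ofReal (∫ x, x ^ 2 ∂μ) :=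
  (ofReal_integral_eq_lintegral_ofReal (memLp_of_secondMoment_ne_top h).integrable_sq
    (Filter.Eventually.of_forall fun x => sq_nonneg x)).symm

/-- A standardization argument: unless `μ` is centered with unit variance, centering and scaling
it up improves the mutual information. -/
lemma exists_channelInfo_gt_of_not_standardized (b : ℝ) {μ : Measure ℝ} [IsProbabilityMeasure μ]
    {s : ℝ} (hμ : secondMoment μ ≤ 1) (hI : channelInfo μ s ≠ 0)
    (hst : ¬ (∫ x, x ∂μ = 0 ∧ variance (fun x : ℝ => x) μ = 1)) :
    ∃ ν : Measure ℝ, IsProbabilityMeasure ν ∧ secondMoment ν ≤ 1 ∧ entropy b ν ≤ entropy b μ ∧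
      channelInfo μ s < channelInfo ν s := by
  have hfin : secondMoment μ ≠ ⊤ := ne_top_of_le_ne_top ENNReal.one_ne_top hμ
  have hL := memLp_of_secondMoment_ne_top hfin
  have h1 : ∫ x, x ^ 2 ∂μ ≤ 1 := by
    rw [secondMoment_eq_ofReal_integral hfin] at hμ
    simpa using hμ
  set m := ∫ x, x ∂μ with hm
  set σ := variance (fun x : ℝ => x) μ with hσ
  have hvar : σ = ∫ x, x ^ 2 ∂μ - m ^ 2 := variance_eq_sub hL
  have hσ0 : 0 ≤ σ := variance_nonneg _ _
  -- Since `σ = E[X²] - m² ≤ 1 - m²`, unit variance would force a zero mean; failing to be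
  -- standardized thus means variance below `1`.
  have hσ1 : σ < 1 := by
    refine lt_of_le_of_ne (by nlinarith [sq_nonneg m]) fun h => hst ⟨?_, h⟩
    have : m ^ 2 ≤ 0 := by linarith
    exact pow_eq_zero_iff two_ne_zero |>.1 (le_antisymm this (sq_nonneg m))
  have hvar2 : σ = ∫ x, (x - m) ^ 2 ∂μ := variance_eq_integral (by fun_prop)
  -- This choice gives `a² > 1` and `a² σ = 2σ / (1 + σ) ≤ 1`. Unlike `1 / σ`, it needs no separate
  -- treatment of `σ = 0`.
  set a := √(2 / (1 + σ)) with ha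
  have ha2 : a ^ 2 = 2 / (1 + σ) := Real.sq_sqrt (by positivity)
  have ha2' : 1 < a ^ 2 := by
    rw [ha2, lt_div_iff₀ (by positivity)]
    linarith
  have ha0 : a ≠ 0 := fun h => by
    rw [h] at ha2'
    norm_num at ha2'
  have hc : a⁻¹ ^ 2 < 1 := by
    rw [inv_pow]
    exact inv_lt_one_of_one_lt₀ ha2'
  have hmap : channelInfo (μ.map fun x => a * (x - m)) s = channelInfo μ (a * s) :=
    channelInfo_map_affine μ s a m
  have has : a⁻¹ * (a * s) = s := by field_simp
  refine ⟨μ.map fun x => a * (x - m), Measure.isProbabilityMeasure_map (by fun_prop), ?_,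
    entropy_map_le b μ (by fun_prop) ⟨fun x y h => ?_, fun y => ⟨y / a + m, ?_⟩⟩, ?_⟩
  · rw [secondMoment, lintegral_map (by fun_prop) (by fun_prop)]
    have : Integrable (fun x => (a * (x - m)) ^ 2) μ :=
      ((hL.sub (memLp_const m)).const_mul a).integrable_sq
    rw [← ofReal_integral_eq_lintegral_ofReal this (Filter.Eventually.of_forall fun x =>
      sq_nonneg _)]
    simp_rw [mul_pow]
    rw [integral_const_mul, ← hvar2, ha2, ENNReal.ofReal_le_one, div_mul_eq_mul_div,
      div_le_one (by positivity)]
    linarith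
  · simpa [ha0] using h
  · simp only [add_sub_cancel_right]
    field_simp
  · rw [hmap]
    have hle := channelInfo_degraded_le (μ := μ) (s := a * s) hc
    have hlt := channelInfo_degraded_lt (μ := μ) (s := a * s) hc
    rw [has] at hle hlt
    exact hlt (fun h => hI (le_antisymm (h ▸ hle) zero_le)) (channelInfo_ne_top _ hfin)

/-! ### Gaussian inputs and the maximal output entropy -/

lemma map_add_gaussianReal_eq_conv (μ : Measure ℝ) [IsProbabilityMeasure μ] (s : ℝ) :
    (μ.map (s * ·)).conv (gaussianReal 0 1) = volume.withDensity (outputDensity μ s) := by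
  rw [← map_add_gaussianReal, Measure.conv]
  have h : (μ.map (s * ·)).prod (gaussianReal 0 1) =
      (μ.prod (gaussianReal 0 1)).map (Prod.map (s * ·) id) := by
    rw [← Measure.map_prod_map _ _ (by fun_prop) measurable_id, Measure.map_id]
  rw [h, Measure.map_map (by fun_prop) (by fun_prop)]
  rfl

lemma outputDensity_gaussianReal_ae (w : NNReal) (s : ℝ) :
    outputDensity (gaussianReal 0 w) s =ᵐ[volume]
      gaussianPDF 0 (⟨s ^ 2, sq_nonneg s⟩ * w + 1) := by
  have h := map_add_gaussianReal_eq_conv (gaussianReal 0 w) s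
  rw [gaussianReal_map_const_mul, gaussianReal_conv_gaussianReal, mul_zero, add_zero,
    gaussianReal_of_var_ne_zero _ (by positivity)] at h
  refine ((withDensity_eq_iff (measurable_gaussianPDF _ _).aemeasurable
    (measurable_outputDensity _ _).aemeasurable ?_).1 h).symm
  rw [lintegral_gaussianPDF_eq_one _ (by positivity)]
  exact ENNReal.one_ne_top

lemma outputEntropy_gaussianReal (w : NNReal) (s : ℝ) :
    outputEntropy (gaussianReal 0 w) s =
      ENNReal.ofReal (Real.log (s ^ 2 * w + 1) / 2 + 1 / 2) := by
  set v : NNReal := ⟨s ^ 2, sq_nonneg s⟩ * w + 1 with hv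
  have hvr : (v : ℝ) = s ^ 2 * w + 1 := rfl
  have hv1 : 1 ≤ v := le_add_self
  have hv1' : (1 : ℝ) ≤ v := by exact_mod_cast hv1
  have hK : outputDiv v (gaussianReal 0 w) s = 0 := by
    rw [outputDiv, lintegral_congr_ae (g := fun _ => 0), lintegral_zero]
    filter_upwards [outputDensity_gaussianReal_ae w s] with y hy
    have h0 := gaussianPDFReal_pos 0 v y (by positivity)
    rw [hy, toReal_gaussianPDF, div_self h0.ne', InformationTheory.klFun_one, ENNReal.ofReal_zero,
      mul_zero]
  have h := outputEntropy_add_outputDiv (gaussianReal 0 w) s hv1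
  rw [hK, add_zero, secondMoment_gaussianReal] at h
  rw [h, ← ENNReal.ofReal_mul (sq_nonneg s), ← ENNReal.ofReal_one,
    ← ENNReal.ofReal_add zero_le_one (by positivity), ← ENNReal.ofReal_mul (by positivity),
    ← ENNReal.ofReal_add (by have := Real.log_nonneg hv1'; positivity) (by positivity), hvr]
  congr 2
  have : s ^ 2 * (w : ℝ) + 1 ≠ 0 := by positivity
  field_simp
  ring

/-- Zero divergence makes the output exactly Gaussian; the noise can then be cancelled from the
convolution because its characteristic function has no zeros. -/
lemma eq_gaussianReal_of_outputDiv_eq_zero {μ : Measure ℝ} [IsProbabilityMeasure μ] {s : ℝ}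
    {w : NNReal} (hK : outputDiv (w + 1) μ s = 0) : μ.map (s * ·) = gaussianReal 0 w := by
  have hv0 : w + 1 ≠ 0 := by positivity
  have hm : Measurable fun y => gaussianPDF 0 (w + 1) y * ENNReal.ofReal (InformationTheory.klFun
      ((outputDensity μ s y).toReal / gaussianPDFReal 0 (w + 1) y)) :=
    (measurable_gaussianPDF _ _).mul (ENNReal.measurable_ofReal.comp
      (InformationTheory.measurable_klFun.comp
        ((measurable_outputDensity μ s).ennreal_toReal.div (measurable_gaussianPDFReal _ _))))
  rw [outputDiv, lintegral_eq_zero_iff hm] at hK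
  have hae : outputDensity μ s =ᵐ[volume] gaussianPDF 0 (w + 1) := by
    filter_upwards [hK] with y hy
    have h0 := gaussianPDFReal_pos 0 (w + 1) y hv0
    have h1 := outputDensity_toReal_pos μ s y
    have h2 := (mul_eq_zero.1 hy).resolve_left (gaussianPDF_pos 0 hv0 y).ne'
    rw [ENNReal.ofReal_eq_zero] at h2
    have h3 := (InformationTheory.klFun_eq_zero_iff (div_pos h1 h0).le).1
      (le_antisymm h2 (InformationTheory.klFun_nonneg (div_pos h1 h0).le))
    rw [div_eq_one_iff_eq h0.ne'] at h3
    rw [← ofReal_outputDensity_toReal, h3, gaussianPDF]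
  have hp : IsProbabilityMeasure (μ.map (s * ·)) := Measure.isProbabilityMeasure_map (by fun_prop)
  have hconv : (μ.map (s * ·)).conv (gaussianReal 0 1) =
      (gaussianReal 0 w).conv (gaussianReal 0 1) := by
    rw [map_add_gaussianReal_eq_conv, withDensity_congr_ae hae, gaussianReal_conv_gaussianReal,
      add_zero, gaussianReal_of_var_ne_zero _ hv0]
  refine Measure.ext_of_charFun (funext fun t => ?_)
  have h := congrFun (congrArg charFun hconv) t
  rw [charFun_conv, charFun_conv] at h
  refine mul_right_cancel₀ ?_ h
  rw [charFun_gaussianReal]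
  exact Complex.exp_ne_zero _

/-- With `v = s² + 1` the bound exceeds the entropy by at least the divergence from `N(0, v)`. This
is nonzero, since otherwise `s X` would be a nondegenerate Gaussian carried by a countable set. -/
lemma outputEntropy_lt_of_countable {μ : Measure ℝ} [IsProbabilityMeasure μ] {s : ℝ} (hs : s ≠ 0)
    (hμ : secondMoment μ ≤ 1) (hd : ∃ S : Set ℝ, S.Countable ∧ μ Sᶜ = 0) :
    outputEntropy μ s < ENNReal.ofReal (Real.log (s ^ 2 + 1) / 2 + 1 / 2) := by
  set w : NNReal := ⟨s ^ 2, sq_nonneg s⟩ with hw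
  have hwr : ((w + 1 : NNReal) : ℝ) = s ^ 2 + 1 := rfl
  have hv1 : 1 ≤ w + 1 := le_add_self
  have hv1' : (1 : ℝ) ≤ ((w + 1 : NNReal) : ℝ) := by exact_mod_cast hv1
  have hw0 : w ≠ 0 := fun h => hs (pow_eq_zero_iff two_ne_zero |>.1 (congrArg NNReal.toReal h))
  have hK : outputDiv (w + 1) μ s ≠ 0 := by
    intro hK
    have h := eq_gaussianReal_of_outputDiv_eq_zero hK
    obtain ⟨S, hS, hμS⟩ := hd
    have hinj : Function.Injective (s * ·) := mul_right_injective₀ hs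
    have hT : ((s * ·) '' S).Countable := hS.image _
    have := nullSingletonClass_gaussianReal (μ := 0) hw0
    have h1 : gaussianReal 0 w ((s * ·) '' S) = 0 := hT.measure_zero _
    rw [← h, Measure.map_apply (by fun_prop) hT.measurableSet, Set.preimage_image_eq _ hinj] at h1
    have h2 := measure_univ_le_add_compl (μ := μ) S
    rw [h1, hμS, measure_univ] at h2
    simp at h2
  have hle : outputEntropy μ s + outputDiv (w + 1) μ s ≤
      ENNReal.ofReal (Real.log (s ^ 2 + 1) / 2 + 1 / 2) := by
    rw [outputEntropy_add_outputDiv μ s hv1]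
    calc _ ≤ ENNReal.ofReal (Real.log (w + 1 : NNReal) / 2) +
          ENNReal.ofReal (1 / (2 * (w + 1 : NNReal))) * (1 + ENNReal.ofReal (s ^ 2) * 1) := by
          gcongr
      _ = _ := by
        rw [mul_one, ← ENNReal.ofReal_one, ← ENNReal.ofReal_add zero_le_one (by positivity),
          ← ENNReal.ofReal_mul (by positivity),
          ← ENNReal.ofReal_add (by have := Real.log_nonneg hv1'; positivity) (by positivity), hwr]
        congr 2
        have : s ^ 2 + 1 ≠ 0 := by positivity
        field_simp
        ring
  have hfin : secondMoment μ ≠ ⊤ := ne_top_of_le_ne_top ENNReal.one_ne_top hμ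
  exact (ENNReal.lt_add_right (outputEntropy_ne_top s hfin) hK).trans_le hle

/-- The strict inequality `w < 1` leaves room in the power constraint for the later quantization. -/
lemma exists_gaussianReal_outputEntropy_gt {s : ℝ} {A : ℝ≥0∞}
    (hA : A < ENNReal.ofReal (Real.log (s ^ 2 + 1) / 2 + 1 / 2)) :
    ∃ w : NNReal, w < 1 ∧ A < outputEntropy (gaussianReal 0 w) s := by
  have hc : ContinuousAt (fun w : ℝ => ENNReal.ofReal
      (Real.log (s ^ 2 * w + 1) / 2 + 1 / 2)) 1 := by
    refine ENNReal.continuous_ofReal.continuousAt.comp ?_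
    refine ((ContinuousAt.log ?_ ?_).div_const _).add_const _
    · fun_prop
    · positivity
  have hev := (hc.eventually (lt_mem_nhds (by simpa using hA))).and
    (lt_mem_nhds (zero_lt_one (α := ℝ)))
  obtain ⟨w, ⟨hw, hw0⟩, hw1⟩ := ((hev.filter_mono nhdsWithin_le_nhds).and
    (self_mem_nhdsWithin (s := Set.Iio (1 : ℝ)))).exists
  lift w to NNReal using hw0.le
  exact ⟨w, by exact_mod_cast hw1, by rwa [outputEntropy_gaussianReal]⟩

/-! ### Lower semicontinuity and quantization -/

section LowerSemicontinuity

variable {μ : Measure ℝ} [IsProbabilityMeasure μ] {μs : ℕ → Measure ℝ}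
  [∀ n, IsProbabilityMeasure (μs n)] {s : ℝ}

/-- Fatou applies because normalizing by the peak made the entropy integrand nonnegative. -/
lemma outputEntropy_le_liminf
    (h : ∀ y, Tendsto (fun n => outputDensity (μs n) s y) atTop (𝓝 (outputDensity μ s y))) :
    outputEntropy μ s ≤ liminf (fun n => outputEntropy (μs n) s) atTop := by
  have hpt : ∀ y, ENNReal.ofReal ((outputDensity μ s y).toReal *
        Real.log (gaussianPeak / (outputDensity μ s y).toReal)) =
      liminf (fun n => ENNReal.ofReal ((outputDensity (μs n) s y).toReal *
        Real.log (gaussianPeak / (outputDensity (μs n) s y).toReal))) atTop := by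
    intro y
    have h1 := (ENNReal.tendsto_toReal (outputDensity_ne_top μ s y)).comp (h y)
    have h0 := outputDensity_toReal_pos μ s y
    refine (ENNReal.tendsto_ofReal (h1.mul ((Tendsto.div tendsto_const_nhds h1 h0.ne').log
      (div_pos gaussianPeak_pos h0).ne'))).liminf_eq.symm
  rw [outputEntropy, lintegral_congr hpt]
  refine lintegral_liminf_le fun n => ?_
  have := (measurable_outputDensity (μs n) s).ennreal_toReal
  fun_prop

lemma outputDiv_le_liminf (v : NNReal)
    (h : ∀ y, Tendsto (fun n => outputDensity (μs n) s y) atTop (𝓝 (outputDensity μ s y))) :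
    outputDiv v μ s ≤ liminf (fun n => outputDiv v (μs n) s) atTop := by
  have hpt : ∀ y, gaussianPDF 0 v y * ENNReal.ofReal
      (InformationTheory.klFun ((outputDensity μ s y).toReal / gaussianPDFReal 0 v y)) =
      liminf (fun n => gaussianPDF 0 v y * ENNReal.ofReal
      (InformationTheory.klFun ((outputDensity (μs n) s y).toReal / gaussianPDFReal 0 v y)))
        atTop := by
    intro y
    have h1 := (ENNReal.tendsto_toReal (outputDensity_ne_top μ s y)).comp (h y)
    refine (ENNReal.Tendsto.const_mul (ENNReal.tendsto_ofReal
      ((InformationTheory.continuous_klFun.tendsto _).comp (h1.div_const _)))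
      (Or.inr gaussianPDF_ne_top)).liminf_eq.symm
  rw [outputDiv, lintegral_congr hpt]
  refine lintegral_liminf_le fun n => ?_
  exact (measurable_gaussianPDF _ _).mul (ENNReal.measurable_ofReal.comp
      (InformationTheory.measurable_klFun.comp
        ((measurable_outputDensity (μs n) s).ennreal_toReal.div (measurable_gaussianPDFReal _ _))))

end LowerSemicontinuity

lemma entropy_ne_top_of_finite (b : ℝ) {ν : Measure ℝ} {S : Set ℝ} (hS : S.Finite)
    (hν : ν Sᶜ = 0) : entropy b ν ≠ ⊤ := by
  unfold entropy
  rw [if_pos ⟨S, hS.countable, hν⟩, tsum_eq_sum (s := hS.toFinset)]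
  · exact ENNReal.sum_ne_top.2 fun _ _ => ENNReal.ofReal_ne_top
  · intro x hx
    have : ν {x} = 0 := measure_mono_null (by simpa using hx) hν
    simp [measureReal_def, this]

/-- Quantized Gaussian inputs approach the Gaussian output entropy. -/
lemma exists_finite_outputEntropy_gt {s : ℝ} {A : ℝ≥0∞}
    (hA : A < ENNReal.ofReal (Real.log (s ^ 2 + 1) / 2 + 1 / 2)) (b : ℝ) :
    ∃ ν : Measure ℝ, IsProbabilityMeasure ν ∧ secondMoment ν ≤ 1 ∧ entropy b ν ≠ ⊤ ∧
      A < outputEntropy ν s := by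
  obtain ⟨w, hw1, hw⟩ := exists_gaussianReal_outputEntropy_gt hA
  set γ := gaussianReal 0 w with hγ
  set q : ℕ → SimpleFunc ℝ ℝ := fun n => SimpleFunc.approxOn (fun x : ℝ => x) measurable_id
    Set.univ 0 (Set.mem_univ _) n with hq
  have hqt : ∀ x, Tendsto (fun n => q n x) atTop (𝓝 x) := fun x =>
    SimpleFunc.tendsto_approxOn measurable_id (Set.mem_univ _) (by simp)
  have hqb : ∀ n x, |q n x| ≤ |x| + |x| := fun n x =>
    SimpleFunc.norm_approxOn_zero_le measurable_id (Set.mem_univ _) x n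
  have hprob : ∀ n, IsProbabilityMeasure (γ.map (q n)) := fun n =>
    Measure.isProbabilityMeasure_map (q n).measurable.aemeasurable
  have hod : ∀ y, Tendsto (fun n => outputDensity (γ.map (q n)) s y) atTop
      (𝓝 (outputDensity γ s y)) := by
    intro y
    have h1 : ∀ n, outputDensity (γ.map (q n)) s y = ∫⁻ x, gaussianPDF (s * q n x) 1 y ∂γ :=
      fun n => lintegral_map (measurable_gaussianPDF_left s 1 y) (q n).measurable
    simp_rw [h1]
    refine tendsto_lintegral_of_dominated_convergence (fun _ => ENNReal.ofReal gaussianPeak)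
      (fun n => (measurable_gaussianPDF_left s 1 y).comp (q n).measurable)
      (fun n => ae_of_all _ fun x => ENNReal.ofReal_le_ofReal (gaussianPDFReal_one_le _ _))
      (by simp) (ae_of_all _ fun x => ?_)
    have hc : Continuous fun x => gaussianPDF (s * x) 1 y := by
      unfold gaussianPDF gaussianPDFReal
      exact ENNReal.continuous_ofReal.comp (by fun_prop)
    exact (hc.tendsto x).comp (hqt x)
  have hm2 : Tendsto (fun n => secondMoment (γ.map (q n))) atTop (𝓝 (secondMoment γ)) := by
    have h1 : ∀ n, secondMoment (γ.map (q n)) = ∫⁻ x, ENNReal.ofReal (q n x ^ 2) ∂γ :=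
      fun n => lintegral_map (by fun_prop) (q n).measurable
    simp_rw [h1]
    refine tendsto_lintegral_of_dominated_convergence (fun x => ENNReal.ofReal 4 *
      ENNReal.ofReal (x ^ 2)) (fun n => ?_) (fun n => ae_of_all _ fun x => ?_) ?_
      (ae_of_all _ fun x => ENNReal.tendsto_ofReal ((hqt x).pow 2))
    · exact ((q n).measurable.pow_const 2).ennreal_ofReal
    · simp only
      rw [← ENNReal.ofReal_mul (by norm_num)]
      refine ENNReal.ofReal_le_ofReal ?_
      have := hqb n x
      rw [← sq_abs, ← sq_abs x]
      nlinarith [abs_nonneg (q n x), abs_nonneg x]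
    · rw [lintegral_const_mul _ (by fun_prop)]
      change _ * secondMoment γ ≠ ⊤
      rw [secondMoment_gaussianReal]
      finiteness
  have hev1 : ∀ᶠ n in atTop, A < outputEntropy (γ.map (q n)) s :=
    eventually_lt_of_lt_liminf (hw.trans_le (outputEntropy_le_liminf hod))
  have hev2 : ∀ᶠ n in atTop, secondMoment (γ.map (q n)) < 1 := by
    refine hm2.eventually (gt_mem_nhds ?_)
    rw [secondMoment_gaussianReal]
    simpa using hw1
  obtain ⟨n, h1, h2⟩ := (hev1.and hev2).exists
  refine ⟨γ.map (q n), hprob n, h2.le, entropy_ne_top_of_finite b (q n).finite_range ?_, h1⟩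
  rw [Measure.map_apply (q n).measurable (q n).finite_range.measurableSet.compl]
  simp

/-! ### Entropy and output entropy of mixtures -/

lemma entropy_of_countable (b : ℝ) {μ : Measure ℝ} (h : ∃ S : Set ℝ, S.Countable ∧ μ Sᶜ = 0) :
    entropy b μ = ∑' x : ℝ, ENNReal.ofReal (μ.real {x} * Real.logb b (1 / μ.real {x})) := by
  unfold entropy
  rw [if_pos h]

lemma countable_of_entropy_ne_top {b : ℝ} {μ : Measure ℝ} (h : entropy b μ ≠ ⊤) :
    ∃ S : Set ℝ, S.Countable ∧ μ Sᶜ = 0 := by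
  by_contra hcon
  exact h (if_neg hcon)

lemma mul_logb_inv_nonneg {b p : ℝ} (hb : 1 < b) (hp0 : 0 ≤ p) (hp1 : p ≤ 1) :
    0 ≤ p * Real.logb b (1 / p) := by
  rcases hp0.eq_or_lt with rfl | hp
  · simp
  · exact mul_nonneg hp0 (Real.logb_nonneg hb ((one_le_div hp).2 hp1))

lemma mul_logb_inv_antitone {b p q : ℝ} (hb : 1 < b) (hp : 0 < p) (hpq : p ≤ q) :
    p * Real.logb b (1 / q) ≤ p * Real.logb b (1 / p) := by
  refine mul_le_mul_of_nonneg_left ?_ hp.le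
  exact Real.logb_le_logb_of_le hb (by have := hp.trans_le hpq; positivity)
    (one_div_le_one_div_of_le hp hpq)

lemma mul_logb_inv_add_le {b p q : ℝ} (hb : 1 < b) (hp : 0 ≤ p) (hq : 0 ≤ q) :
    (p + q) * Real.logb b (1 / (p + q)) ≤
      p * Real.logb b (1 / p) + q * Real.logb b (1 / q) := by
  rcases hp.eq_or_lt with rfl | hp
  · simp
  rcases hq.eq_or_lt with rfl | hq
  · simp
  rw [add_mul]
  exact add_le_add (mul_logb_inv_antitone hb hp (by linarith))
    (mul_logb_inv_antitone hb hq (by linarith))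

lemma mul_mul_logb_inv {b p q : ℝ} :
    (p * q) * Real.logb b (1 / (p * q)) =
      p * (q * Real.logb b (1 / q)) + q * (p * Real.logb b (1 / p)) := by
  rcases eq_or_ne p 0 with rfl | hp
  · simp
  rcases eq_or_ne q 0 with rfl | hq
  · simp
  rw [one_div, one_div, one_div, Real.logb_inv, Real.logb_inv, Real.logb_inv, Real.logb_mul hp hq]
  ring

lemma continuous_mul_logb_inv (b : ℝ) : Continuous fun p : ℝ => p * Real.logb b (1 / p) := by
  have : ∀ p : ℝ, p * Real.logb b (1 / p) = Real.negMulLog p / Real.log b := fun p => by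
    rw [Real.logb, one_div, Real.log_inv, Real.negMulLog]
    ring
  simp_rw [this]
  exact Real.continuous_negMulLog.div_const _

lemma tsum_measure_singleton_le (μ : Measure ℝ) : ∑' x : ℝ, μ {x} ≤ μ Set.univ := by
  refine (tsum_meas_le_meas_iUnion_of_disjoint μ (fun x => measurableSet_singleton x) ?_).trans
    (measure_mono (Set.subset_univ _))
  intro x y hxy
  simpa [Function.onFun] using hxy

/-- The mixture `(1 - t) μ + t ν`. -/
noncomputable def mixture (t : ℝ) (μ ν : Measure ℝ) : Measure ℝ :=
  ENNReal.ofReal (1 - t) • μ + ENNReal.ofReal t • ν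

lemma lintegral_mixture (t : ℝ) (μ ν : Measure ℝ) (f : ℝ → ℝ≥0∞) : ∫⁻ x, f x ∂(mixture t μ ν) =
    ENNReal.ofReal (1 - t) * ∫⁻ x, f x ∂μ + ENNReal.ofReal t * ∫⁻ x, f x ∂ν := by
  simp [mixture]

lemma secondMoment_mixture_le {μ ν : Measure ℝ} {t : ℝ} (h0 : 0 ≤ t) (h1 : t ≤ 1)
    (hμ : secondMoment μ ≤ 1) (hν : secondMoment ν ≤ 1) : secondMoment (mixture t μ ν) ≤ 1 := by
  unfold secondMoment at *
  rw [lintegral_mixture]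
  calc _ ≤ ENNReal.ofReal (1 - t) * 1 + ENNReal.ofReal t * 1 := by gcongr
    _ = 1 := by
      rw [mul_one, mul_one, ← ENNReal.ofReal_add (by linarith) h0]
      simp

section Mixture

variable {μ ν : Measure ℝ} [IsProbabilityMeasure μ] [IsProbabilityMeasure ν] {t : ℝ}

lemma isProbabilityMeasure_mixture (h0 : 0 ≤ t) (h1 : t ≤ 1) :
    IsProbabilityMeasure (mixture t μ ν) := by
  constructor
  simp only [mixture, Measure.add_apply, Measure.smul_apply, measure_univ, smul_eq_mul, mul_one]
  rw [← ENNReal.ofReal_add (by linarith) h0]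
  simp

lemma concaveOn_mul_log_div {c : ℝ} (hc : 0 < c) :
    ConcaveOn ℝ (Set.Ici 0) fun u : ℝ => u * Real.log (c / u) := by
  have h1 : ConcaveOn ℝ (Set.Ici (0 : ℝ)) fun u => Real.negMulLog u + u * Real.log c :=
    Real.concaveOn_negMulLog.add ((LinearMap.mulRight ℝ (Real.log c)).concaveOn (convex_Ici 0))
  refine h1.congr fun u hu => ?_
  rcases (Set.mem_Ici.1 hu).eq_or_lt with rfl | hu
  · simp
  · simp only [Real.log_div hc.ne' hu.ne', Real.negMulLog]
    ring

/-- The output density is affine in the input law, and `u log (peak / u)` is concave. -/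
lemma outputEntropy_mixture_ge (s : ℝ) (h0 : 0 ≤ t) (h1 : t ≤ 1) :
    ENNReal.ofReal (1 - t) * outputEntropy μ s + ENNReal.ofReal t * outputEntropy ν s ≤
      outputEntropy (mixture t μ ν) s := by
  have h1' : 0 ≤ 1 - t := by linarith
  unfold outputEntropy
  have hm : ∀ (μ : Measure ℝ) [IsProbabilityMeasure μ], Measurable fun y =>
      ENNReal.ofReal ((outputDensity μ s y).toReal *
        Real.log (gaussianPeak / (outputDensity μ s y).toReal)) := fun μ _ => by
    have := (measurable_outputDensity μ s).ennreal_toReal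
    fun_prop
  rw [← lintegral_const_mul _ (hm μ), ← lintegral_const_mul _ (hm ν),
    ← lintegral_add_left ((hm μ).const_mul _)]
  refine lintegral_mono fun y => ?_
  have hp := outputDensity_toReal_pos μ s y
  have hq := outputDensity_toReal_pos ν s y
  have hmix : (outputDensity (mixture t μ ν) s y).toReal =
      (1 - t) * (outputDensity μ s y).toReal + t * (outputDensity ν s y).toReal := by
    rw [outputDensity, lintegral_mixture]
    change (ENNReal.ofReal (1 - t) * outputDensity μ s y +
      ENNReal.ofReal t * outputDensity ν s y).toReal = _
    have := outputDensity_ne_top μ s y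
    have := outputDensity_ne_top ν s y
    rw [ENNReal.toReal_add (by finiteness) (by finiteness), ENNReal.toReal_mul, ENNReal.toReal_mul,
      ENNReal.toReal_ofReal h1', ENNReal.toReal_ofReal h0]
  have hpn := mul_nonneg hp.le (log_gaussianPeak_div_nonneg μ s y)
  have hqn := mul_nonneg hq.le (log_gaussianPeak_div_nonneg ν s y)
  have hconc := (concaveOn_mul_log_div gaussianPeak_pos).2 (Set.mem_Ici.2 hp.le)
    (Set.mem_Ici.2 hq.le) h1' h0 (by ring)
  simp only [smul_eq_mul] at hconc
  rw [hmix, ← ENNReal.ofReal_mul h1', ← ENNReal.ofReal_mul h0,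
    ← ENNReal.ofReal_add (by positivity) (by positivity)]
  exact ENNReal.ofReal_le_ofReal hconc

/-- With `η p = p log (1 / p)`, the bound is summed over atoms from the subadditivity of `η` and the
product rule `η (p q) = p η q + q η p`. The last two terms are the binary entropy of the mixing
variable. -/
lemma entropy_mixture_le {b : ℝ} (hb : 1 < b) (h0 : 0 ≤ t) (h1 : t ≤ 1) (hμ : entropy b μ ≠ ⊤)
    (hν : entropy b ν ≠ ⊤) :
    entropy b (mixture t μ ν) ≤ ENNReal.ofReal (1 - t) * entropy b μ +
      ENNReal.ofReal t * entropy b ν + (ENNReal.ofReal ((1 - t) * Real.logb b (1 / (1 - t))) +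
        ENNReal.ofReal (t * Real.logb b (1 / t))) := by
  have h1' : 0 ≤ 1 - t := by linarith
  have hdμ := countable_of_entropy_ne_top hμ
  have hdν := countable_of_entropy_ne_top hν
  have hd : ∃ S : Set ℝ, S.Countable ∧ mixture t μ ν Sᶜ = 0 := by
    obtain ⟨S, hS, hSμ⟩ := hdμ
    obtain ⟨T, hT, hTν⟩ := hdν
    refine ⟨S ∪ T, hS.union hT, ?_⟩
    have h2 : μ (S ∪ T)ᶜ = 0 :=
      measure_mono_null (Set.compl_subset_compl.2 Set.subset_union_left) hSμ
    have h3 : ν (S ∪ T)ᶜ = 0 :=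
      measure_mono_null (Set.compl_subset_compl.2 Set.subset_union_right) hTν
    simp only [mixture, Measure.add_apply, Measure.smul_apply, h2, h3, smul_zero, add_zero]
  rw [entropy_of_countable b hd, entropy_of_countable b hdμ, entropy_of_countable b hdν]
  set η : ℝ → ℝ := fun p => p * Real.logb b (1 / p) with hη
  have hη0 : ∀ {p : ℝ}, 0 ≤ p → p ≤ 1 → 0 ≤ η p := fun hp0 hp1 =>
    mul_logb_inv_nonneg hb hp0 hp1
  have hpt : ∀ x, ENNReal.ofReal (η ((mixture t μ ν).real {x})) ≤
      ENNReal.ofReal (1 - t) * ENNReal.ofReal (η (μ.real {x})) +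
      ENNReal.ofReal t * ENNReal.ofReal (η (ν.real {x})) +
      (ENNReal.ofReal (η (1 - t)) * μ {x} + ENNReal.ofReal (η t) * ν {x}) := by
    intro x
    have hp0 : 0 ≤ μ.real {x} := measureReal_nonneg
    have hq0 : 0 ≤ ν.real {x} := measureReal_nonneg
    have hp1 : μ.real {x} ≤ 1 := measureReal_le_one
    have hq1 : ν.real {x} ≤ 1 := measureReal_le_one
    have hmix : (mixture t μ ν).real {x} = (1 - t) * μ.real {x} + t * ν.real {x} := by
      simp only [mixture, measureReal_def, Measure.add_apply, Measure.smul_apply, smul_eq_mul]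
      rw [ENNReal.toReal_add (by finiteness) (by finiteness), ENNReal.toReal_mul,
        ENNReal.toReal_mul, ENNReal.toReal_ofReal h1', ENNReal.toReal_ofReal h0]
    have e1 := hη0 hp0 hp1
    have e2 := hη0 hq0 hq1
    have e3 := hη0 h0 h1
    have e4 := hη0 h1' (by linarith)
    rw [← ofReal_measureReal (μ := μ), ← ofReal_measureReal (μ := ν),
      ← ENNReal.ofReal_mul h1', ← ENNReal.ofReal_mul h0, ← ENNReal.ofReal_mul e3,
      ← ENNReal.ofReal_mul e4, ← ENNReal.ofReal_add (by positivity) (by positivity),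
      ← ENNReal.ofReal_add (by positivity) (by positivity),
      ← ENNReal.ofReal_add (by positivity) (by positivity), hmix]
    refine ENNReal.ofReal_le_ofReal ((mul_logb_inv_add_le hb (by positivity)
      (by positivity)).trans (le_of_eq ?_))
    rw [mul_mul_logb_inv, mul_mul_logb_inv]
    ring
  calc _ ≤ ∑' x, (ENNReal.ofReal (1 - t) * ENNReal.ofReal (η (μ.real {x})) +
      ENNReal.ofReal t * ENNReal.ofReal (η (ν.real {x})) +
      (ENNReal.ofReal (η (1 - t)) * μ {x} + ENNReal.ofReal (η t) * ν {x})) :=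
        ENNReal.tsum_le_tsum hpt
    _ = ENNReal.ofReal (1 - t) * ∑' x, ENNReal.ofReal (η (μ.real {x})) +
      ENNReal.ofReal t * ∑' x, ENNReal.ofReal (η (ν.real {x})) +
      (ENNReal.ofReal (η (1 - t)) * ∑' x, μ {x} + ENNReal.ofReal (η t) * ∑' x, ν {x}) := by
        simp_rw [ENNReal.tsum_add, ENNReal.tsum_mul_left]
    _ ≤ _ := by
        refine add_le_add le_rfl (add_le_add (mul_le_of_le_one_right' ?_)
          (mul_le_of_le_one_right' ?_))
        · simpa using tsum_measure_singleton_le μ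
        · simpa using tsum_measure_singleton_le ν

end Mixture

/-- If the entropy constraint is slack, mixing in a quantized Gaussian improves the mutual
information. -/
lemma exists_channelInfo_gt_of_entropy_lt {b : ℝ} (hb : 1 < b) {μ : Measure ℝ}
    [IsProbabilityMeasure μ] {s : ℝ} (hs : s ≠ 0) {h : ℝ≥0∞} (hμ : secondMoment μ ≤ 1)
    (hH : entropy b μ < h) :
    ∃ ν : Measure ℝ, IsProbabilityMeasure ν ∧ secondMoment ν ≤ 1 ∧ entropy b ν ≤ h ∧
      channelInfo μ s < channelInfo ν s := by
  have hfin : secondMoment μ ≠ ⊤ := ne_top_of_le_ne_top ENNReal.one_ne_top hμ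
  obtain ⟨ν, hν, hν2, hνH, hνJ⟩ := exists_finite_outputEntropy_gt
    (outputEntropy_lt_of_countable hs hμ (countable_of_entropy_ne_top hH.ne_top)) b
  have hη : Continuous fun p : ℝ => ENNReal.ofReal (p * Real.logb b (1 / p)) :=
    ENNReal.continuous_ofReal.comp (continuous_mul_logb_inv b)
  -- As `t → 0` the entropy bound for the mixture returns to `entropy b μ`, so a small `t > 0` fits
  -- within the slack.
  have hlim : Tendsto (fun t : ℝ => ENNReal.ofReal (1 - t) * entropy b μ +
      ENNReal.ofReal t * entropy b ν + (ENNReal.ofReal ((1 - t) * Real.logb b (1 / (1 - t))) +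
        ENNReal.ofReal (t * Real.logb b (1 / t)))) (𝓝 0) (𝓝 (entropy b μ)) := by
    have h1 : Tendsto (fun t : ℝ => 1 - t) (𝓝 0) (𝓝 1) := by
      have : Continuous fun t : ℝ => 1 - t := by fun_prop
      simpa using this.tendsto 0
    have e1 := ENNReal.Tendsto.mul_const (b := entropy b μ) (ENNReal.tendsto_ofReal h1)
      (Or.inr hH.ne_top)
    have e2 := ENNReal.Tendsto.mul_const (b := entropy b ν)
      (ENNReal.tendsto_ofReal (tendsto_id (x := 𝓝 (0 : ℝ)))) (Or.inr hνH)
    have := (e1.add e2).add (((hη.tendsto 1).comp h1).add (hη.tendsto 0))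
    simpa using this
  obtain ⟨t, ⟨ht, ht1⟩, ht0⟩ := ((((hlim.eventually (gt_mem_nhds hH)).and
    (gt_mem_nhds (zero_lt_one (α := ℝ)))).filter_mono nhdsWithin_le_nhds).and
    (self_mem_nhdsWithin (s := Set.Ioi (0 : ℝ)))).exists
  have ht0' : 0 < t := ht0
  have hp : IsProbabilityMeasure (mixture t μ ν) := isProbabilityMeasure_mixture ht0'.le ht1.le
  refine ⟨mixture t μ ν, hp, secondMoment_mixture_le ht0'.le ht1.le hμ hν2,
    (entropy_mixture_le hb ht0'.le ht1.le hH.ne_top hνH).trans ht.le,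
    channelInfo_lt_of_outputEntropy_lt (lt_of_lt_of_le ?_
      (outputEntropy_mixture_ge s ht0'.le ht1.le))⟩
  have hJ := outputEntropy_ne_top s hfin
  calc outputEntropy μ s
      = ENNReal.ofReal (1 - t) * outputEntropy μ s + ENNReal.ofReal t * outputEntropy μ s := by
        rw [← add_mul, ← ENNReal.ofReal_add (by linarith) ht0'.le]
        simp
    _ < _ := by
        refine ENNReal.add_lt_add_left (by finiteness) ?_
        exact ENNReal.mul_lt_mul_right (by simpa using ht0') ENNReal.ofReal_ne_top hνJ

/-! ### Indexing atoms by mass level -/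

/-- The reciprocal of the mass of an atom, rounded down. -/
noncomputable def atomLevel (μ : Measure ℝ) (x : ℝ) : ℕ := ⌊1 / μ.real {x}⌋₊

lemma atomLevel_mul_le (μ : Measure ℝ) (x : ℝ) : (atomLevel μ x : ℝ) * μ.real {x} ≤ 1 := by
  have h0 : 0 ≤ μ.real {x} := measureReal_nonneg
  have h1 : (atomLevel μ x : ℝ) ≤ 1 / μ.real {x} := Nat.floor_le (by positivity)
  rcases h0.eq_or_lt with h | h
  · simp [← h]
  · exact (le_div_iff₀ h).1 h1

/-- An atom of level `k` has mass at least `1 / (k + 1)`, and the total mass is `1`. -/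
lemma card_le_of_atomLevel_eq (μ : Measure ℝ) [IsProbabilityMeasure μ] (k : ℕ) {t : Finset ℝ}
    (ht : ∀ x ∈ t, μ {x} ≠ 0 ∧ atomLevel μ x = k) : t.card ≤ k + 1 := by
  have h1 : ∀ x ∈ t, 1 / ((k : ℝ) + 1) ≤ μ.real {x} := fun x hx => by
    have hpos : 0 < μ.real {x} := ENNReal.toReal_pos (ht x hx).1 (measure_ne_top _ _)
    have h2 : 1 / μ.real {x} < atomLevel μ x + 1 := Nat.lt_floor_add_one _
    rw [(ht x hx).2] at h2
    exact (one_div_le hpos (by positivity)).1 h2.le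
  have h2 : ∑ x ∈ t, μ.real {x} ≤ 1 := by
    have h3 : ∑ x ∈ t, μ {x} ≤ 1 :=
      (ENNReal.sum_le_tsum t).trans ((tsum_measure_singleton_le μ).trans_eq measure_univ)
    simp only [measureReal_def]
    rw [← ENNReal.toReal_sum fun x _ => measure_ne_top _ _]
    exact ENNReal.toReal_le_of_le_ofReal zero_le_one (by simpa using h3)
  have h3 := (Finset.card_nsmul_le_sum t _ _ h1).trans h2
  rw [nsmul_eq_mul, mul_one_div, div_le_one (by positivity)] at h3
  exact_mod_cast h3

/-- The atoms of each level can be numbered injectively with few numbers. -/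
lemma exists_atom_numbering (μ : Measure ℝ) [IsProbabilityMeasure μ] (k : ℕ) :
    ∃ e : ℝ → ℕ, (∀ x, e x ≤ k) ∧
      Set.InjOn e {x | μ {x} ≠ 0 ∧ atomLevel μ x = k} := by
  set T : Set ℝ := {x | μ {x} ≠ 0 ∧ atomLevel μ x = k} with hT
  have hfin : T.Finite := by
    by_contra hinf
    obtain ⟨t, htT, hcard⟩ := Set.Infinite.exists_subset_card_eq hinf (k + 2)
    have := card_le_of_atomLevel_eq μ k (t := t) fun x hx => htT hx
    omega
  have hcard : hfin.toFinset.card ≤ k + 1 :=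
    card_le_of_atomLevel_eq μ k fun x hx => hfin.mem_toFinset.1 hx
  classical
  refine ⟨fun x => if h : x ∈ hfin.toFinset then (hfin.toFinset.equivFin ⟨x, h⟩).val else 0,
    fun x => ?_, fun x hx y hy hxy => ?_⟩
  · by_cases h : x ∈ hfin.toFinset
    · simp only [h, dif_pos]
      have := (hfin.toFinset.equivFin ⟨x, h⟩).isLt
      omega
    · simp [h]
  · have hx' := hfin.mem_toFinset.2 hx
    have hy' := hfin.mem_toFinset.2 hy
    simp only [hx', hy', dif_pos] at hxy
    have := hfin.toFinset.equivFin.injective (Fin.ext hxy)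
    exact congrArg Subtype.val this

/-- A discrete distribution is given by masses and positions indexed by `ℕ × ℕ`, in such a way that
the number of indices carrying a mass above a given threshold is bounded independently of the
distribution. -/
lemma exists_indexed_atoms (b : ℝ) (μ : Measure ℝ) [IsProbabilityMeasure μ]
    (hd : ∃ S : Set ℝ, S.Countable ∧ μ Sᶜ = 0) :
    ∃ (p : ℕ × ℕ → ℝ≥0∞) (x : ℕ × ℕ → ℝ),
      (∀ f : ℝ → ℝ≥0∞, ∫⁻ y, f y ∂μ = ∑' j, p j * f (x j)) ∧
      (∑' j, ENNReal.ofReal ((p j).toReal * Real.logb b (1 / (p j).toReal)) = entropy b μ) ∧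
      ∀ j, p j ≠ 0 → j.2 ≤ j.1 ∧ (j.1 : ℝ) * (p j).toReal ≤ 1 := by
  choose e hek hinj using exists_atom_numbering μ
  set A : Set ℝ := {x | μ {x} ≠ 0} with hA
  -- An atom is placed at its level and its number within that level; unoccupied indices get mass
  -- `0` and the arbitrary position `0`.
  set slot : A → ℕ × ℕ := fun a => (atomLevel μ a, e (atomLevel μ a) a) with hslot
  have hs : Function.Injective slot := by
    rintro ⟨x, hx⟩ ⟨y, hy⟩ hxy
    simp only [hslot, Prod.mk.injEq] at hxy
    obtain ⟨h1, h2⟩ := hxy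
    rw [h1] at h2
    exact Subtype.ext (hinj _ ⟨hx, h1⟩ ⟨hy, rfl⟩ h2)
  set p : ℕ × ℕ → ℝ≥0∞ := Function.extend slot (fun a => μ {(a : ℝ)}) 0 with hp
  set x : ℕ × ℕ → ℝ := Function.extend slot (fun a => (a : ℝ)) 0 with hx
  have hps : ∀ a, p (slot a) = μ {(a : ℝ)} := fun a => hs.extend_apply _ _ _
  have hxs : ∀ a, x (slot a) = a := fun a => hs.extend_apply _ _ _
  have hrange : ∀ j, p j ≠ 0 → j ∈ Set.range slot := fun j hj => by
    by_contra h
    exact hj (Function.extend_apply' _ _ _ h)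
  have htsum : ∀ g : ℕ × ℕ → ℝ≥0∞, (∀ j, p j = 0 → g j = 0) →
      ∑' j, g j = ∑' a, g (slot a) := fun g hg =>
    (hs.tsum_eq fun j hj => hrange j fun h => hj (hg j h)).symm
  obtain ⟨S, hS, hμS⟩ := hd
  have hAS : A ⊆ S := fun y hy => by
    by_contra h
    exact hy (measure_mono_null (Set.singleton_subset_iff.2 h) hμS)
  have hAc : A.Countable := hS.mono hAS
  have hμA : μ Aᶜ = 0 := by
    have h1 : Aᶜ ⊆ Sᶜ ∪ ⋃ y ∈ S \ A, {y} := fun y hy => by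
      by_cases h : y ∈ S
      · exact Or.inr (Set.mem_biUnion ⟨h, hy⟩ rfl)
      · exact Or.inl h
    refine measure_mono_null h1 (measure_union_null hμS ?_)
    exact (measure_biUnion_null_iff (hS.mono Set.sdiff_subset)).2 fun y hy => not_not.1 hy.2
  refine ⟨p, x, fun f => ?_, ?_, fun j hj => ?_⟩
  · rw [htsum _ fun j hj => by rw [hj, zero_mul]]
    have h1 : μ.restrict A = μ := Measure.restrict_eq_self_of_ae_mem (by
      rw [ae_iff]
      exact hμA)
    conv_lhs => rw [← h1]
    rw [lintegral_countable f hAc]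
    exact tsum_congr fun a => by rw [hps, hxs, mul_comm]
  · rw [htsum _ fun j hj => by simp [hj], entropy_of_countable b ⟨S, hS, hμS⟩]
    simp_rw [hps]
    refine tsum_subtype_eq_of_support_subset
      (f := fun y => ENNReal.ofReal (μ.real {y} * Real.logb b (1 / μ.real {y}))) fun y hy => ?_
    intro h
    rw [Function.mem_support] at hy
    simp [measureReal_def, h] at hy
  · obtain ⟨a, rfl⟩ := hrange j hj
    refine ⟨hek _ _, ?_⟩
    rw [hps]
    exact atomLevel_mul_le μ a

/-! ### Measures given by masses and positions -/

/-- The measure with masses `p j` at the points `x j`. -/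
noncomputable def atomicMeasure {ι : Type*} (p : ι → ℝ≥0∞) (x : ι → ℝ) : Measure ℝ :=
  Measure.sum fun j => p j • Measure.dirac (x j)

section Atomic

variable {ι : Type*} {p : ι → ℝ≥0∞} {x : ι → ℝ}

lemma lintegral_atomicMeasure (f : ℝ → ℝ≥0∞) :
    ∫⁻ y, f y ∂(atomicMeasure p x) = ∑' j, p j * f (x j) := by
  rw [atomicMeasure, lintegral_sum_measure]
  exact tsum_congr fun j => by rw [lintegral_smul_measure, lintegral_dirac, smul_eq_mul]

lemma isProbabilityMeasure_atomicMeasure (hp : ∑' j, p j = 1) :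
    IsProbabilityMeasure (atomicMeasure p x) := by
  constructor
  rw [← lintegral_one, lintegral_atomicMeasure]
  simpa using hp

lemma exists_countable_atomicMeasure [Countable ι] :
    ∃ S : Set ℝ, S.Countable ∧ atomicMeasure p x Sᶜ = 0 := by
  refine ⟨Set.range x, Set.countable_range x, ?_⟩
  rw [atomicMeasure, Measure.sum_apply _ (Set.countable_range x).measurableSet.compl]
  simp

open Classical in
lemma atomicMeasure_singleton (y : ℝ) :
    atomicMeasure p x {y} = ∑' j, if x j = y then p j else 0 := by
  rw [atomicMeasure, Measure.sum_apply _ (measurableSet_singleton y)]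
  refine tsum_congr fun j => ?_
  by_cases h : x j = y <;> simp [h]

/-- Merging atoms decreases entropy. -/
lemma entropy_atomicMeasure_le [Countable ι] {b : ℝ} (hb : 1 < b) (hp : ∑' j, p j = 1) :
    entropy b (atomicMeasure p x) ≤
      ∑' j, ENNReal.ofReal ((p j).toReal * Real.logb b (1 / (p j).toReal)) := by
  classical
  have := isProbabilityMeasure_atomicMeasure (x := x) hp
  have hp1 : ∀ j, p j ≤ 1 := fun j => hp ▸ ENNReal.le_tsum j
  have hpt : ∀ j, p j ≠ ⊤ := fun j => ne_top_of_le_ne_top ENNReal.one_ne_top (hp1 j)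
  rw [entropy_of_countable b exists_countable_atomicMeasure]
  set c : ι → ℝ≥0∞ := fun j => ENNReal.ofReal ((p j).toReal * Real.logb b (1 / (p j).toReal))
    with hc
  -- The mass at `y` is split among the indices located at `y`; each has smaller mass, hence a
  -- larger logarithm.
  have hpt : ∀ y, ENNReal.ofReal ((atomicMeasure p x).real {y} *
      Real.logb b (1 / (atomicMeasure p x).real {y})) ≤ ∑' j, if x j = y then c j else 0 := by
    intro y
    rw [ENNReal.ofReal_mul measureReal_nonneg, ofReal_measureReal, atomicMeasure_singleton,
      ← ENNReal.tsum_mul_right]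
    refine ENNReal.tsum_le_tsum fun j => ?_
    split_ifs with hj
    · rcases eq_or_ne (p j) 0 with h0 | h0
      · simp [h0]
      · have hpos : 0 < (p j).toReal := ENNReal.toReal_pos h0 (hpt j)
        have hle : (p j).toReal ≤ (atomicMeasure p x).real {y} := by
          refine ENNReal.toReal_mono (measure_ne_top _ _) ?_
          rw [atomicMeasure_singleton]
          exact le_trans (by simp [hj]) (ENNReal.le_tsum j)
        calc p j * ENNReal.ofReal (Real.logb b (1 / (atomicMeasure p x).real {y}))
            = ENNReal.ofReal ((p j).toReal *
                Real.logb b (1 / (atomicMeasure p x).real {y})) := by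
              rw [ENNReal.ofReal_mul hpos.le, ENNReal.ofReal_toReal (hpt j)]
          _ ≤ c j := ENNReal.ofReal_le_ofReal (mul_logb_inv_antitone hb hpos hle)
    · simp
  refine (ENNReal.tsum_le_tsum hpt).trans ?_
  rw [ENNReal.tsum_comm]
  refine ENNReal.tsum_le_tsum fun j => ?_
  rw [tsum_ite_eq' (x j) (fun _ => c j)]

end Atomic

/-! ### Compactness of masses and positions -/

lemma tsum_le_liminf_tsum {ι : Type*} {f : ι → ℝ≥0∞} {g : ℕ → ι → ℝ≥0∞}
    (h : ∀ j, f j ≤ liminf (fun n => g n j) atTop) :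
    ∑' j, f j ≤ liminf (fun n => ∑' j, g n j) atTop := by
  let _ : MeasurableSpace ι := ⊤
  simp_rw [← lintegral_count]
  exact (lintegral_mono h).trans (lintegral_liminf_le fun n => measurable_from_top)

/-- Lower bounds on two sequences with constant sum are also upper bounds on each other. This
upgrades Fatou to convergence for bounded functions. -/
lemma tendsto_of_add_eq_const {f g : ℕ → ℝ≥0∞} {a b c : ℝ≥0∞} (hc : c ≠ ⊤)
    (hfg : ∀ n, f n + g n = c) (hab : a + b = c) (hf : a ≤ liminf f atTop)
    (hg : b ≤ liminf g atTop) : Tendsto f atTop (𝓝 a) := by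
  refine tendsto_of_le_liminf_of_limsup_le hf ?_
  have hgt : ∀ n, g n ≠ ⊤ := fun n => ne_top_of_le_ne_top hc (hfg n ▸ le_add_self)
  have hbt : b ≠ ⊤ := ne_top_of_le_ne_top hc (hab ▸ le_add_self)
  have h1 : f = fun n => c - g n := funext fun n => ENNReal.eq_sub_of_add_eq (hgt n) (hfg n)
  rw [h1, ENNReal.limsup_const_sub _ _ hc, ENNReal.eq_sub_of_add_eq hbt hab]
  exact tsub_le_tsub_left hg c

section Compactness

variable {p : ℕ → ℕ × ℕ → ℝ≥0∞} {x : ℕ → ℕ × ℕ → ℝ} {P : ℕ × ℕ → ℝ≥0∞} {X : ℕ × ℕ → ℝ}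

/-- A bound on the entropy makes the masses uniformly summable. -/
lemma one_le_sum_add {b : ℝ} (hb : 1 < b) {h : ℝ≥0∞} {q : ℕ × ℕ → ℝ≥0∞} (hq : ∑' j, q j = 1)
    (hH : ∑' j, ENNReal.ofReal ((q j).toReal * Real.logb b (1 / (q j).toReal)) ≤ h)
    (hlev : ∀ j, q j ≠ 0 → j.2 ≤ j.1 ∧ (j.1 : ℝ) * (q j).toReal ≤ 1) {N : ℕ} (hN : 2 ≤ N) :
    1 ≤ ∑ j ∈ Finset.range N ×ˢ Finset.range N, q j +
      (ENNReal.ofReal (Real.logb b N))⁻¹ * h := by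
  classical
  have hN' : (1 : ℝ) < N := by exact_mod_cast hN
  have hlog : 0 < Real.logb b N := Real.logb_pos hb hN'
  -- Numbers never exceed levels, so an occupied index outside the square has level at least `N`.
  -- Its mass is then at most `1 / N`, and the mass times `log N` is at most its entropy term.
  have hpt : ∀ j, q j ≤ (if j ∈ Finset.range N ×ˢ Finset.range N then q j else 0) +
      (ENNReal.ofReal (Real.logb b N))⁻¹ *
        ENNReal.ofReal ((q j).toReal * Real.logb b (1 / (q j).toReal)) := by
    intro j
    split_ifs with hj
    · exact le_self_add
    · rw [zero_add]
      rcases eq_or_ne (q j) 0 with h0 | h0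
      · simp [h0]
      have ht : q j ≠ ⊤ := ne_top_of_le_ne_top ENNReal.one_ne_top (hq ▸ ENNReal.le_tsum j)
      have hpos : 0 < (q j).toReal := ENNReal.toReal_pos h0 ht
      obtain ⟨h1, h2⟩ := hlev j h0
      have hNj : N ≤ j.1 := by
        by_contra hlt
        exact hj (Finset.mem_product.2 ⟨Finset.mem_range.2 (by omega),
          Finset.mem_range.2 (by omega)⟩)
      have h3 : (N : ℝ) ≤ 1 / (q j).toReal := by
        rw [le_div_iff₀ hpos]
        refine le_trans ?_ h2
        gcongr
      rw [← ENNReal.div_eq_inv_mul, ENNReal.le_div_iff_mul_le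
        (Or.inl (by simpa using hlog)) (Or.inl ENNReal.ofReal_ne_top)]
      calc q j * ENNReal.ofReal (Real.logb b N)
          = ENNReal.ofReal ((q j).toReal * Real.logb b N) := by
            rw [ENNReal.ofReal_mul hpos.le, ENNReal.ofReal_toReal ht]
        _ ≤ _ := by
            refine ENNReal.ofReal_le_ofReal (mul_le_mul_of_nonneg_left ?_ hpos.le)
            exact Real.logb_le_logb_of_le hb (by linarith) h3
  calc 1 = ∑' j, q j := hq.symm
    _ ≤ _ := ENNReal.tsum_le_tsum hpt
    _ = ∑ j ∈ Finset.range N ×ˢ Finset.range N, q j + (ENNReal.ofReal (Real.logb b N))⁻¹ *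
        ∑' j, ENNReal.ofReal ((q j).toReal * Real.logb b (1 / (q j).toReal)) := by
      rw [ENNReal.tsum_add, ENNReal.tsum_mul_left]
      congr 1
      rw [tsum_eq_sum (s := Finset.range N ×ˢ Finset.range N) fun j hj => if_neg hj]
      exact Finset.sum_congr rfl fun j hj => if_pos hj
    _ ≤ _ := by gcongr

/-- Fatou gives one inequality. For the other, the mass outside the `N × N` square is at most `h /
log N` uniformly in `n`, which tends to `0`. -/
lemma tsum_limit_eq_one {b : ℝ} (hb : 1 < b) {h : ℝ≥0∞} (hh : h ≠ ⊤) (hp : ∀ n, ∑' j, p n j = 1)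
    (hH : ∀ n, ∑' j, ENNReal.ofReal ((p n j).toReal * Real.logb b (1 / (p n j).toReal)) ≤ h)
    (hlev : ∀ n j, p n j ≠ 0 → j.2 ≤ j.1 ∧ (j.1 : ℝ) * (p n j).toReal ≤ 1)
    (hP : ∀ j, Tendsto (fun n => p n j) atTop (𝓝 (P j))) : ∑' j, P j = 1 := by
  refine le_antisymm ?_ ?_
  · refine (tsum_le_liminf_tsum fun j => (hP j).liminf_eq.ge).trans ?_
    simp [hp]
  · have h1 : ∀ N : ℕ, 2 ≤ N → 1 ≤ ∑' j, P j + (ENNReal.ofReal (Real.logb b N))⁻¹ * h := by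
      intro N hN
      have h2 : Tendsto (fun n => ∑ j ∈ Finset.range N ×ˢ Finset.range N, p n j +
          (ENNReal.ofReal (Real.logb b N))⁻¹ * h) atTop
          (𝓝 (∑ j ∈ Finset.range N ×ˢ Finset.range N, P j +
            (ENNReal.ofReal (Real.logb b N))⁻¹ * h)) :=
        (tendsto_finsetSum _ fun j _ => hP j).add_const _
      refine (ge_of_tendsto' h2 fun n => one_le_sum_add hb (hp n) (hH n) (hlev n) hN).trans ?_
      gcongr
      exact ENNReal.sum_le_tsum _
    have h3 : Tendsto (fun N : ℕ => ∑' j, P j + (ENNReal.ofReal (Real.logb b N))⁻¹ * h) atTop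
        (𝓝 (∑' j, P j + 0 * h)) := by
      refine tendsto_const_nhds.add (ENNReal.Tendsto.mul_const ?_ (Or.inr hh))
      rw [← ENNReal.inv_top]
      refine tendsto_inv_iff.2 (ENNReal.tendsto_ofReal_atTop.comp ?_)
      exact (Real.tendsto_logb_atTop hb).comp tendsto_natCast_atTop_atTop
    rw [zero_mul, add_zero] at h3
    exact ge_of_tendsto h3 (eventually_atTop.2 ⟨2, h1⟩)

/-- Masses and positions with bounded second moment have a subsequence along which the masses
converge, and the positions converge wherever the limiting mass does not vanish. -/
lemma exists_subseq_atoms (hm : ∀ n, ∑' j, p n j * ENNReal.ofReal (x n j ^ 2) ≤ 1) :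
    ∃ (P : ℕ × ℕ → ℝ≥0∞) (X : ℕ × ℕ → ℝ) (φ : ℕ → ℕ), StrictMono φ ∧
      (∀ j, Tendsto (fun n => p (φ n) j) atTop (𝓝 (P j))) ∧
      ∀ j, P j ≠ 0 → Tendsto (fun n => x (φ n) j) atTop (𝓝 (X j)) := by
  -- Embedding positions in `EReal` makes the countable product of mass-position pairs sequentially
  -- compact; infinite limits are excluded afterwards.
  obtain ⟨Z, φ, hφ, hZ⟩ := CompactSpace.tendsto_subseq
    fun n => fun j : ℕ × ℕ => (p n j, (x n j : EReal))
  rw [tendsto_pi_nhds] at hZ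
  have hZ1 : ∀ j, Tendsto (fun n => p (φ n) j) atTop (𝓝 (Z j).1) := fun j =>
    (continuous_fst.tendsto (Z j)).comp (hZ j)
  have hZ2 : ∀ j, Tendsto (fun n => (x (φ n) j : EReal)) atTop (𝓝 (Z j).2) := fun j =>
    (continuous_snd.tendsto (Z j)).comp (hZ j)
  refine ⟨fun j => (Z j).1, fun j => (Z j).2.toReal, φ, hφ, hZ1, fun j hj => ?_⟩
  have hle : ∀ n, p (φ n) j * ENNReal.ofReal (x (φ n) j ^ 2) ≤ 1 := fun n =>
    (ENNReal.le_tsum j).trans (hm (φ n))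
  have hno : ¬ Tendsto (fun n => |x (φ n) j|) atTop atTop := fun hinf => by
    have h1 : Tendsto (fun n => x (φ n) j ^ 2) atTop atTop := by
      have := (tendsto_pow_atTop (α := ℝ) two_ne_zero).comp hinf
      simpa [Function.comp_def, sq_abs] using this
    have h2 := ENNReal.Tendsto.mul (hZ1 j) (Or.inl hj)
      (ENNReal.tendsto_ofReal_atTop.comp h1) (Or.inl ENNReal.top_ne_zero)
    have h3 := le_of_tendsto' h2 hle
    rw [ENNReal.mul_top hj] at h3
    exact absurd h3 (by simp)
  have htop : (Z j).2 ≠ ⊤ := fun h => hno <| by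
    have := hZ2 j
    rw [h, EReal.tendsto_coe_nhds_top_iff] at this
    exact tendsto_abs_atTop_atTop.comp this
  have hbot : (Z j).2 ≠ ⊥ := fun h => hno <| by
    have := hZ2 j
    rw [h, EReal.tendsto_coe_nhds_bot_iff] at this
    exact tendsto_abs_atBot_atTop.comp this
  simpa [Function.comp_def] using (EReal.tendsto_toReal htop hbot).comp (hZ2 j)

/-- Where the limiting mass vanishes the bound is trivial, so atoms whose positions do not converge
do no harm. -/
lemma mul_le_liminf_of_tendsto {f : ℝ → ℝ≥0∞} (hf : Continuous f) (j : ℕ × ℕ)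
    (hP : Tendsto (fun n => p n j) atTop (𝓝 (P j))) (hPt : P j ≠ ⊤)
    (hX : P j ≠ 0 → Tendsto (fun n => x n j) atTop (𝓝 (X j))) :
    P j * f (X j) ≤ liminf (fun n => p n j * f (x n j)) atTop := by
  rcases eq_or_ne (P j) 0 with h0 | h0
  · simp [h0]
  · exact (ENNReal.Tendsto.mul hP (Or.inl h0) ((hf.tendsto _).comp (hX h0))
      (Or.inr hPt)).liminf_eq.ge

end Compactness

/-! ### Upper semicontinuity and existence of a maximizer -/

/-- Upper semicontinuity of the output entropy under a second moment constraint. -/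
lemma outputEntropy_ge_of_tendsto {μ : Measure ℝ} [IsProbabilityMeasure μ] {μs : ℕ → Measure ℝ}
    [∀ n, IsProbabilityMeasure (μs n)] {s : ℝ} {J : ℝ≥0∞}
    (hod : ∀ y, Tendsto (fun n => outputDensity (μs n) s y) atTop (𝓝 (outputDensity μ s y)))
    (hμ : secondMoment μ ≤ 1) (hm : ∀ n, secondMoment (μs n) ≤ 1)
    (hJ : Tendsto (fun n => outputEntropy (μs n) s) atTop (𝓝 J)) : J ≤ outputEntropy μ s := by
  have hfin : ∀ {ν : Measure ℝ}, secondMoment ν ≤ 1 → secondMoment ν ≠ ⊤ := fun h =>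
    ne_top_of_le_ne_top ENNReal.one_ne_top h
  have hJt := outputEntropy_ne_top s (hfin hμ)
  -- The limit may have a smaller second moment than the sequence. In the identity with divergence
  -- from `N(0, v)` this costs at most `s² / (2v)`, which disappears as `v → ∞`.
  have hv : ∀ v : NNReal, 1 ≤ v →
      J ≤ outputEntropy μ s + ENNReal.ofReal (1 / (2 * v)) * ENNReal.ofReal (s ^ 2) := by
    intro v hv
    set c := ENNReal.ofReal (1 / (2 * v)) with hc
    set B := outputEntropy μ s + outputDiv v μ s + c * ENNReal.ofReal (s ^ 2) with hB
    have hKt := outputDiv_ne_top s hv (hfin hμ)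
    have hBt : B ≠ ⊤ := by finiteness
    have hle : ∀ n, outputEntropy (μs n) s ≤ B - outputDiv v (μs n) s := fun n => by
      refine ENNReal.le_sub_of_add_le_right (outputDiv_ne_top s hv (hfin (hm n))) ?_
      rw [outputEntropy_add_outputDiv _ s hv, hB, outputEntropy_add_outputDiv _ s hv]
      calc _ ≤ ENNReal.ofReal (Real.log v / 2) + c * (1 + ENNReal.ofReal (s ^ 2) * 1) := by
            gcongr
            exact hm n
        _ = ENNReal.ofReal (Real.log v / 2) + c * (1 + 0) + c * ENNReal.ofReal (s ^ 2) := by ring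
        _ ≤ _ := by
            gcongr
            exact zero_le
    calc J = limsup (fun n => outputEntropy (μs n) s) atTop := hJ.limsup_eq.symm
      _ ≤ limsup (fun n => B - outputDiv v (μs n) s) atTop :=
        limsup_le_limsup (Eventually.of_forall hle)
      _ = B - liminf (fun n => outputDiv v (μs n) s) atTop := ENNReal.limsup_const_sub _ _ hBt
      _ ≤ B - outputDiv v μ s := tsub_le_tsub_left (outputDiv_le_liminf v hod) _
      _ = _ := by
        rw [hB, add_right_comm]
        exact ENNReal.add_sub_cancel_right hKt
  have hlim : Tendsto (fun n : ℕ => outputEntropy μ s +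
      ENNReal.ofReal (1 / (2 * ((n : NNReal) : ℝ))) * ENNReal.ofReal (s ^ 2)) atTop
      (𝓝 (outputEntropy μ s + ENNReal.ofReal 0 * ENNReal.ofReal (s ^ 2))) := by
    refine tendsto_const_nhds.add (ENNReal.Tendsto.mul_const (ENNReal.tendsto_ofReal ?_)
      (Or.inr ENNReal.ofReal_ne_top))
    simp only [NNReal.coe_natCast, one_div]
    exact tendsto_inv_atTop_zero.comp
      (tendsto_natCast_atTop_atTop.const_mul_atTop (by norm_num))
  rw [ENNReal.ofReal_zero, zero_mul, add_zero] at hlim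
  exact ge_of_tendsto hlim (eventually_atTop.2 ⟨1, fun n hn => hv n (by exact_mod_cast hn)⟩)

lemma entropy_dirac (b a : ℝ) : entropy b (Measure.dirac a) = 0 := by
  rw [entropy_of_countable b ⟨{a}, Set.countable_singleton a, by simp⟩, ENNReal.tsum_eq_zero]
  intro x
  by_cases h : a = x <;> simp [measureReal_def, h]

/-- A limit of feasible inputs, along a sequence for which the output entropy converges. -/
lemma exists_limit_input {b : ℝ} (hb : 1 < b) {s : ℝ} {h J : ℝ≥0∞} (hh : h ≠ ⊤)
    {ν : ℕ → Measure ℝ} [∀ n, IsProbabilityMeasure (ν n)] (hm : ∀ n, secondMoment (ν n) ≤ 1)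
    (hH : ∀ n, entropy b (ν n) ≤ h)
    (hJ : Tendsto (fun n => outputEntropy (ν n) s) atTop (𝓝 J)) :
    ∃ μ : Measure ℝ, IsProbabilityMeasure μ ∧ secondMoment μ ≤ 1 ∧ entropy b μ ≤ h ∧
      J ≤ outputEntropy μ s := by
  choose p x hint hent hlev using fun n => exists_indexed_atoms b (ν n)
    (countable_of_entropy_ne_top (ne_top_of_le_ne_top hh (hH n)))
  have hm' : ∀ n, ∑' j, p n j * ENNReal.ofReal (x n j ^ 2) ≤ 1 := fun n => by
    rw [← hint n fun y => ENNReal.ofReal (y ^ 2)]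
    exact hm n
  have hp1 : ∀ n, ∑' j, p n j = 1 := fun n => by
    have := hint n fun _ => 1
    simpa using this.symm
  obtain ⟨P, X, φ, hφ, hP, hX⟩ := exists_subseq_atoms hm'
  have hP1 : ∑' j, P j = 1 := tsum_limit_eq_one hb hh (fun n => hp1 (φ n))
    (fun n => (hent (φ n)).trans_le (hH _)) (fun n => hlev (φ n)) hP
  have hPt : ∀ j, P j ≠ ⊤ := fun j =>
    ne_top_of_le_ne_top ENNReal.one_ne_top (hP1 ▸ ENNReal.le_tsum j)
  have hprob := isProbabilityMeasure_atomicMeasure (x := X) hP1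
  have hfatou : ∀ f : ℝ → ℝ≥0∞, Continuous f → ∫⁻ y, f y ∂(atomicMeasure P X) ≤
      liminf (fun n => ∫⁻ y, f y ∂(ν (φ n))) atTop := fun f hf => by
    simp_rw [hint]
    rw [lintegral_atomicMeasure]
    exact tsum_le_liminf_tsum fun j => mul_le_liminf_of_tendsto hf j (hP j) (hPt j) (hX j)
  have hmom : secondMoment (atomicMeasure P X) ≤ 1 :=
    (hfatou _ (ENNReal.continuous_ofReal.comp (continuous_pow 2))).trans
      (liminf_le_of_le (by isBoundedDefault) fun a ha => by
        obtain ⟨n, hn⟩ := ha.exists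
        exact hn.trans (hm (φ n)))
  refine ⟨atomicMeasure P X, hprob, hmom, ?_, ?_⟩
  · refine (entropy_atomicMeasure_le hb hP1).trans ((tsum_le_liminf_tsum
      (g := fun n j => ENNReal.ofReal ((p (φ n) j).toReal * Real.logb b (1 / (p (φ n) j).toReal)))
      fun j => ?_).trans (liminf_le_of_le (by isBoundedDefault) fun a ha => ?_))
    · exact (ENNReal.tendsto_ofReal (((continuous_mul_logb_inv b).tendsto _).comp
        ((ENNReal.tendsto_toReal (hPt j)).comp (hP j)))).liminf_eq.ge
    · obtain ⟨n, hn⟩ := ha.exists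
      exact hn.trans ((hent (φ n)).trans_le (hH _))
  · refine outputEntropy_ge_of_tendsto (μs := fun n => ν (φ n)) (fun y => ?_) hmom
      (fun n => hm (φ n)) (hJ.comp hφ.tendsto_atTop)
    have hle : ∀ x, gaussianPDF (s * x) 1 y ≤ ENNReal.ofReal gaussianPeak := fun x =>
      ENNReal.ofReal_le_ofReal (gaussianPDFReal_one_le _ _)
    have hg : Continuous fun x => gaussianPDF (s * x) 1 y := by
      unfold gaussianPDF gaussianPDFReal
      exact ENNReal.continuous_ofReal.comp (by fun_prop)
    -- Fatou for the kernel and for its complement to the peak together give convergence of the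
    -- output densities.
    have hg' : Continuous fun x => ENNReal.ofReal gaussianPeak - gaussianPDF (s * x) 1 y :=
      (ENNReal.continuous_sub_left ENNReal.ofReal_ne_top).comp hg
    have hsum : ∀ (μ : Measure ℝ) [IsProbabilityMeasure μ],
        ∫⁻ x, gaussianPDF (s * x) 1 y ∂μ +
          ∫⁻ x, (ENNReal.ofReal gaussianPeak - gaussianPDF (s * x) 1 y) ∂μ =
        ENNReal.ofReal gaussianPeak := fun μ _ => by
      rw [← lintegral_add_left (measurable_gaussianPDF_left s 1 y),
        lintegral_congr fun x => add_tsub_cancel_of_le (hle x)]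
      simp
    exact tendsto_of_add_eq_const ENNReal.ofReal_ne_top (fun n => hsum (ν (φ n)))
      (hsum (atomicMeasure P X)) (hfatou _ hg) (hfatou _ hg')

lemma exists_maximizing_input {b : ℝ} (hb : 1 < b) (s : ℝ) {h : ℝ≥0∞} (hh : h ≠ ⊤) :
    ∃ μ : Measure ℝ, IsProbabilityMeasure μ ∧ secondMoment μ ≤ 1 ∧ entropy b μ ≤ h ∧
      ∀ ν : Measure ℝ, IsProbabilityMeasure ν → secondMoment ν ≤ 1 → entropy b ν ≤ h →
        channelInfo ν s ≤ channelInfo μ s := by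
  set V : Set ℝ≥0∞ := {J | ∃ ν : Measure ℝ, IsProbabilityMeasure ν ∧ secondMoment ν ≤ 1 ∧
    entropy b ν ≤ h ∧ outputEntropy ν s = J} with hV
  have hne : V.Nonempty := ⟨_, Measure.dirac 0, inferInstance, by simp [secondMoment],
    by simp [entropy_dirac], rfl⟩
  obtain ⟨u, -, hu, huV⟩ := exists_seq_tendsto_sSup hne (OrderTop.bddAbove V)
  choose ν hν hm hH hJ using huV
  have hlim : Tendsto (fun n => outputEntropy (ν n) s) atTop (𝓝 (sSup V)) := by
    simpa only [hJ] using hu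
  obtain ⟨μ, hμ, hμm, hμH, hμJ⟩ := exists_limit_input hb hh hm hH hlim
  exact ⟨μ, hμ, hμm, hμH, fun ξ hξ hξm hξH =>
    channelInfo_le_of_outputEntropy_le
      ((le_sSup (show outputEntropy ξ s ∈ V from ⟨ξ, hξ, hξm, hξH, rfl⟩)).trans hμJ)⟩

/-! ### Attainment and properties of maximizers -/

theorem proposition1 (b : ℝ) (hb : 1 < b) (h snr : ℝ) (hh : 0 < h) (hsnr : 0 < snr) :
    entropyCapacity b h snr ≠ ⊤ ∧
    (∃ μ ∈ feasibleInputs b h,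
      gaussianChannelInfo b (μ : Measure ℝ) snr = entropyCapacity b h snr) ∧
    (∀ μ ∈ feasibleInputs b h,
      gaussianChannelInfo b (μ : Measure ℝ) snr = entropyCapacity b h snr →
        ∫ x, x ∂(μ : Measure ℝ) = 0 ∧
        variance (fun x : ℝ => x) (μ : Measure ℝ) = 1 ∧
        entropy b (μ : Measure ℝ) = ENNReal.ofReal h) := by
  have hs : √snr ≠ 0 := (Real.sqrt_pos.2 hsnr).ne'
  have hlog : ENNReal.ofReal (Real.log b) ≠ 0 := by simpa using Real.log_pos hb
  obtain ⟨μ, hμ, hμm, hμH, hmax⟩ := exists_maximizing_input hb √snr (h := ENNReal.ofReal h)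
    ENNReal.ofReal_ne_top
  have hcap : entropyCapacity b h snr = channelInfo μ √snr / ENNReal.ofReal (Real.log b) := by
    refine le_antisymm (iSup₂_le fun ξ hξ => ?_) ?_
    · rw [gaussianChannelInfo_eq]
      exact ENNReal.div_le_div_right (hmax ξ inferInstance hξ.1 hξ.2) _
    · rw [← gaussianChannelInfo_eq]
      exact le_iSup₂_of_le (⟨μ, hμ⟩ : ProbabilityMeasure ℝ) ⟨hμm, hμH⟩ le_rfl
  refine ⟨?_, ⟨⟨μ, hμ⟩, ⟨hμm, hμH⟩, ?_⟩, fun ξ hξ hξI => ?_⟩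
  · rw [hcap]
    exact ENNReal.div_ne_top
      (channelInfo_ne_top _ (ne_top_of_le_ne_top ENNReal.one_ne_top hμm)) hlog
  · rw [hcap, ← gaussianChannelInfo_eq]
    rfl
  · rw [hcap, gaussianChannelInfo_eq] at hξI
    replace hξI : channelInfo (ξ : Measure ℝ) √snr = channelInfo μ √snr := by
      have := congrArg (· * ENNReal.ofReal (Real.log b)) hξI
      simpa only [ENNReal.div_mul_cancel hlog ENNReal.ofReal_ne_top] using this
    have hnot : ¬ ∃ ν : Measure ℝ, IsProbabilityMeasure ν ∧ secondMoment ν ≤ 1 ∧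
        entropy b ν ≤ ENNReal.ofReal h ∧ channelInfo (ξ : Measure ℝ) √snr < channelInfo ν √snr := by
      rintro ⟨ν, hν, hνm, hνH, hlt⟩
      exact absurd (hmax ν hν hνm hνH) (not_le.2 (hξI ▸ hlt))
    have hent : entropy b (ξ : Measure ℝ) = ENNReal.ofReal h :=
      hξ.2.eq_or_lt.resolve_right fun hlt =>
        hnot (exists_channelInfo_gt_of_entropy_lt hb hs hξ.1 hlt)
    -- The point mass at `0` has zero entropy, strictly below `h`, so some feasible input strictly
    -- improves on it and has positive information.
    have hI : channelInfo (ξ : Measure ℝ) √snr ≠ 0 := by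
      obtain ⟨ν, hν, hνm, hνH, hlt⟩ := exists_channelInfo_gt_of_entropy_lt hb hs
        (μ := Measure.dirac (0 : ℝ)) (h := ENNReal.ofReal h) (by simp [secondMoment])
        (by simpa [entropy_dirac] using hh)
      rw [hξI]
      exact (zero_le.trans_lt (hlt.trans_le (hmax ν hν hνm hνH))).ne'
    have hst := not_not.1 fun hst : ¬ (∫ x, x ∂(ξ : Measure ℝ) = 0 ∧
        variance (fun x : ℝ => x) (ξ : Measure ℝ) = 1) => hnot <| by
      obtain ⟨ν, hν, hνm, hνH, hlt⟩ := exists_channelInfo_gt_of_not_standardized b hξ.1 hI hst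
      exact ⟨ν, hν, hνm, hνH.trans hξ.2, hlt⟩
    exact ⟨hst.1, hst.2, hent⟩
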